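/- \textbf{Theorem (Super-polynomial GPD of Sublevel-Rips and Sublevel-\v{C}ech filtrations).} \emph{Conventions.} Fix a field $\mathbb{F}$. An interval of a poset $P$ is a nonempty, convex, connected subset of $P$. For a functor $M$ from $P$ to $\mathbb{F}$-vector spaces and an interval $I$, let $\mathrm{rk}_M(I)$ be the rank of the canonical map $\varprojlim M|_I\to\varinjlim M|_I$. The generalized persistence diagram (GPD) of $M$ is the function $\mathrm{dgm}_M:\mathrm{Int}(P)\to\mathbb{Z}$ such that $\mathrm{rk}_M(I)=\sum_{J\supseteq I}\mathrm{dgm}_M(J)$ for every interval $I$, with finitely many nonzero summands; its size $\|\mathrm{dgm}_M\|$ is the cardinality of its support. For a metric space $(X,\mathsf d)$ and $\gamma:X\to\mathbb{R}$, the sublevel-Rips bifiltration $\mathrm{Rips}^{\downarrow}(X,\mathsf d,\gamma)$ over $\mathbb{R}\times\mathbb{R}_{\ge 0}$ consists at $(a,r)$ of the nonempty finite $\sigma\subseteq\gamma^{-1}((-\infty,a])$ with $\mathsf d(x,y)\le r$ for all $x,y\in\sigma$. For $X\subset\mathbb{R}^d$ with $\mathsf d$ the restriction of a metric on $\mathbb{R}^d$,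 the sublevel-\v{C}ech bifiltration $\check{\mathrm C}\mathrm{ech}^{\downarrow}(X,\mathsf d,\gamma)$ consists at $(a,r)$ of the nonempty finite $\sigma\subseteq\gamma^{-1}((-\infty,a])$ whose closed balls of radius $r$ in $\mathbb{R}^d$ have a common point. For a simplicial filtration $\mathcal F$, $\mathrm{dgm}_m(\mathcal F)$ is the GPD of $\mathrm{H}_m(\mathcal F;\mathbb F)$. \emph{(1)} For every finite metric space $X$ and every $\gamma:X\to\mathbb R$, the GPD $\mathrm{dgm}_1(\mathrm{Rips}^{\downarrow}(X,\mathsf d,\gamma))$ exists, is unique and is finitely supported; the same holds for $\mathrm{dgm}_1(\check{\mathrm C}\mathrm{ech}^{\downarrow}(X,\mathsf d,\gamma))$ for every metric on $\mathbb{R}^d$, every finite $X\subset\mathbb{R}^d$ and every $\gamma:X\to\mathbb{R}$. \emph{(2)} There does not exist $k\in\mathbb{Z}_{\ge0}$ such that $\|\mathrm{dgm}_1(\mathrm{Rips}^{\downarrow}(X,\mathsf d,\gamma))\|$ is $O(|X|^k)$ over all finite metric spaces $(X,\mathsf d)$ and all functions $\gamma:X\to\mathbb{R}$. There does not exist $k\in\mathbb{Z}_{\ge0}$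 such that $\|\mathrm{dgm}_1(\check{\mathrm C}\mathrm{ech}^{\downarrow}(X,\mathsf d,\gamma))\|$ is $O(|X|^k)$ over all $d$, all metrics on $\mathbb{R}^d$, all finite $X\subset\mathbb{R}^d$ and all $\gamma:X\to\mathbb{R}$. (Here ``$O(|X|^k)$'' means: there are constants $C,N$ such that the size is at most $C|X|^k$ whenever $|X|\ge N$.) \emph{(3)} Explicit witnesses. Let $n\ge2$, $A=\{(1,0),(0,1),(-1,0),(0,-1)\}$ and $b_j=n-j/n^2$ for $0\le j\le n$. Let $Y_i=\left(\bigcup_{0\le j\le n,\,j\ne i}b_jA\right)\times\{2in\}$ for $0\le i\le n$, $Z_i=b_0A\times\{(2i+1)n\}$ for $0\le i\le n-1$, and $X_n=\bigcup_{i=0}^{n}Y_i\cup\bigcup_{i=0}^{n-1}Z_i\subset\mathbb{R}^3$, with $\mathsf d_n$ the restriction of the supremum metric of $\mathbb{R}^3$. Let $\gamma_n:X_n\to\mathbb{R}$ be $j$ on the points of $\bigcup_i Y_i$ that project into $b_jA$, and $n$ on $\bigcup_i Z_i$. Then $|X_n|=4n(n+2)$. Put $\beta_j=b_{n-j}$,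 so that $\beta_0<\dots<\beta_n$. Let $M$ be the module $\mathrm{H}_0(\mathcal F_n;\mathbb{F})$ over $\{0,\dots,n\}^2$ (product order), where $\mathcal F_n$ has vertices $z_0,\dots,z_n$ and is, at $(i,j)$: empty if $i+j<n$; the set of all vertices except $z_i$ if $i+j=n$; the set of all vertices if $i+j>n$ and $(i,j)\ne(n,n)$; the complete graph on $z_0,\dots,z_n$ if $(i,j)=(n,n)$. Then the pullback of $\mathrm{H}_1(\mathrm{Rips}^{\downarrow}(X_n,\mathsf d_n,\gamma_n);\mathbb{F})$ along $(i,j)\mapsto(i,\beta_j)$ and the pullback of $\mathrm{H}_1(\check{\mathrm C}\mathrm{ech}^{\downarrow}(X_n,\mathsf d_n,\gamma_n);\mathbb{F})$ along $(i,j)\mapsto(i,\beta_j/2)$ are both isomorphic to $M$. The GPD of $M$ exists, is unique and is finitely supported, and each of $\|\mathrm{dgm}_M\|$, $\|\mathrm{dgm}_1(\mathrm{Rips}^{\downarrow}(X_n,\mathsf d_n,\gamma_n))\|$ and $\|\mathrm{dgm}_1(\check{\mathrm C}\mathrm{ech}^{\downarrow}(X_n,\mathsf d_n,\gamma_n))\|$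 is at least $2^{n+1}-1$. -/

import Mathlib

open CategoryTheory CategoryTheory.Limits
open scoped NNReal

universe u

noncomputable section

/-! ### Intervals, generalized rank, generalized persistence diagram -/

/-- An interval of a poset: a nonempty, convex and connected subset. -/
structure PosetInterval (P : Type) [PartialOrder P] where
  carrier : Set P
  nonempty : carrier.Nonempty
  convex : carrier.OrdConnected
  connected : ∀ p q : carrier, Relation.ReflTransGen (fun x y : carrier => x ≤ y ∨ y ≤ x) p q

/-- Persistence modules over a poset `P`: functors from `P` to vector spaces over `𝔽`. -/
abbrev PersistenceModule (𝔽 : Type u) [Field 𝔽] (P : Type) [PartialOrder P] :=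
  P ⥤ ModuleCat.{u} 𝔽

/-- The pullback of a persistence module along a monotone map. -/
def PersistenceModule.comap {𝔽 : Type u} [Field 𝔽] {P Q : Type} [PartialOrder P] [PartialOrder Q]
    (M : PersistenceModule 𝔽 Q) (g : P →o Q) : PersistenceModule 𝔽 P :=
  g.monotone.functor ⋙ M

/-- The restriction of a persistence module over `P` to a subset of `P`. -/
def PersistenceModule.restrict {𝔽 : Type u} [Field 𝔽] {P : Type} [PartialOrder P]
    (M : PersistenceModule 𝔽 P) (I : Set P) : PersistenceModule 𝔽 I :=
  M.comap ⟨fun p : I => (p : P), fun _ _ h => h⟩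

/-- The rank of the limit-to-colimit map `i_p ∘ π_p` of the restriction of `M` to the interval `I`;
since `I` is connected the map does not depend on the point `p` of `I`. -/
def generalizedRank {𝔽 : Type u} [Field 𝔽] {P : Type} [PartialOrder P]
    (M : PersistenceModule 𝔽 P) (I : PosetInterval P) : ℕ :=
  let p : I.carrier := ⟨I.nonempty.some, I.nonempty.some_mem⟩
  Module.finrank 𝔽 (LinearMap.range
    (limit.π (M.restrict I.carrier) p ≫ colimit.ι (M.restrict I.carrier) p).hom)

/-- `f` is a generalized persistence diagram of `M`: for every interval `I`, the rank of `M` over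
`I` is the sum of `f` over the intervals containing `I`, with finitely many nonzero summands. -/
def IsGPD {𝔽 : Type u} [Field 𝔽] {P : Type} [PartialOrder P]
    (M : PersistenceModule 𝔽 P) (f : PosetInterval P → ℤ) : Prop :=
  ∀ I : PosetInterval P,
    {J : PosetInterval P | I.carrier ⊆ J.carrier ∧ f J ≠ 0}.Finite ∧
    (generalizedRank M I : ℤ) = ∑ᶠ (J : PosetInterval P) (_ : I.carrier ⊆ J.carrier), f J

/-- The generalized persistence diagram of `M` (meaningful when it exists and is unique). -/
def gpd {𝔽 : Type u} [Field 𝔽] {P : Type} [PartialOrder P]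
    (M : PersistenceModule 𝔽 P) : PosetInterval P → ℤ :=
  Classical.epsilon (IsGPD M)

/-- The size of the generalized persistence diagram: the cardinality of its support. -/
def gpdSize {𝔽 : Type u} [Field 𝔽] {P : Type} [PartialOrder P]
    (M : PersistenceModule 𝔽 P) : ℕ∞ :=
  (Function.support (gpd M)).encard

/-- The generalized persistence diagram of `M` exists, is unique, and is finitely supported. -/
def HasFiniteGPD {𝔽 : Type u} [Field 𝔽] {P : Type} [PartialOrder P]
    (M : PersistenceModule 𝔽 P) : Prop :=
  (∃! f : PosetInterval P → ℤ, IsGPD M f) ∧ (Function.support (gpd M)).Finite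

/-! ### Simplicial homology -/

section Subquotient

variable {𝔽 : Type u} [Field 𝔽] {W : Type u} [AddCommGroup W] [Module 𝔽 W]

/-- For subspaces `B ≤ Z`, the quotient `Z / B`. -/
def Subquotient (Z B : Submodule 𝔽 W) : Type u := Z ⧸ B.submoduleOf Z

instance (Z B : Submodule 𝔽 W) : AddCommGroup (Subquotient Z B) :=
  inferInstanceAs (AddCommGroup (Z ⧸ B.submoduleOf Z))

instance (Z B : Submodule 𝔽 W) : Module 𝔽 (Subquotient Z B) :=
  inferInstanceAs (Module 𝔽 (Z ⧸ B.submoduleOf Z))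

/-- The class map `Z → Z / B`. -/
def Subquotient.mk (Z B : Submodule 𝔽 W) : Z →ₗ[𝔽] Subquotient Z B :=
  (B.submoduleOf Z).mkQ

theorem Subquotient.mk_surjective (Z B : Submodule 𝔽 W) :
    Function.Surjective (Subquotient.mk Z B) :=
  (B.submoduleOf Z).mkQ_surjective

theorem Subquotient.mk_eq_zero {Z B : Submodule 𝔽 W} (x : Z) :
    Subquotient.mk Z B x = 0 ↔ (x : W) ∈ B :=
  Submodule.Quotient.mk_eq_zero (B.submoduleOf Z)

/-- The map `Z / B → Z' / B'` induced by inclusions `Z ≤ Z'` and `B ≤ B'`. -/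
def Subquotient.map {Z Z' B B' : Submodule 𝔽 W} (hZ : Z ≤ Z') (hB : B ≤ B') :
    Subquotient Z B →ₗ[𝔽] Subquotient Z' B' :=
  Submodule.mapQ (B.submoduleOf Z) (B'.submoduleOf Z') (Submodule.inclusion hZ)
    (fun _ hc => hB hc)

theorem Subquotient.map_mk {Z Z' B B' : Submodule 𝔽 W} (hZ : Z ≤ Z') (hB : B ≤ B') (x : Z) :
    Subquotient.map hZ hB (Subquotient.mk Z B x) =
      Subquotient.mk Z' B' (Submodule.inclusion hZ x) :=
  rfl

end Subquotient

section Homology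

variable (𝔽 : Type u) [Field 𝔽] {V : Type}

/-- Oriented simplicial `m`-chains of `K`: finitely supported functions on orderings
`(v₀, …, v_m)` of the `m`-simplices of `K` that change by the sign of the permutation when the
vertices are permuted. The oriented simplex `[v₀, …, v_m]` is the function with value `sign σ` on
the ordering `v ∘ σ` and value `0` elsewhere. -/
def simplicialChains (K : PreAbstractSimplicialComplex V) (m : ℕ) :
    Submodule 𝔽 ((Fin (m + 1) → V) →₀ 𝔽) where
  carrier := {c |
    (∀ v, c v ≠ 0 → Function.Injective v ∧ ∃ s ∈ K.faces, (s : Set V) = Set.range v) ∧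
    ∀ (σ : Equiv.Perm (Fin (m + 1))) (v : Fin (m + 1) → V),
      c (v ∘ σ) = ((Equiv.Perm.sign σ : ℤ) : 𝔽) * c v}
  add_mem' := by
    rintro c d ⟨hc, hc'⟩ ⟨hd, hd'⟩
    refine ⟨fun v hv => ?_, fun σ v => ?_⟩
    · by_cases h : c v = 0
      · refine hd v fun h' => hv ?_
        simp [h, h']
      · exact hc v h
    · simp [hc', hd', mul_add]
  zero_mem' := by simp
  smul_mem' := by
    rintro a c ⟨hc, hc'⟩
    refine ⟨fun v hv => hc v fun h => hv (by simp [h]), fun σ v => ?_⟩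
    simp only [Finsupp.smul_apply, hc', smul_eq_mul]
    ring

/-- The boundary map. On `c` it is `(∂c)(w₁, …, w_m) = ∑ x, c (x, w₁, …, w_m)`, so the oriented
simplex `[v₀, …, v_m]` goes to the sum of the terms `(-1)^i [v₀, …, v_{i-1}, v_{i+1}, …, v_m]`. -/
def simplicialBoundary (V : Type) (m : ℕ) :
    ((Fin (m + 1) → V) →₀ 𝔽) →ₗ[𝔽] ((Fin m → V) →₀ 𝔽) :=
  Finsupp.lmapDomain 𝔽 𝔽 Fin.tail

/-- The `m`-cycles of `K` (every `0`-chain is a cycle). -/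
def simplicialCycles (K : PreAbstractSimplicialComplex V) (m : ℕ) :
    Submodule 𝔽 ((Fin (m + 1) → V) →₀ 𝔽) :=
  if m = 0 then simplicialChains 𝔽 K m
  else simplicialChains 𝔽 K m ⊓ LinearMap.ker (simplicialBoundary 𝔽 V m)

/-- The `m`-boundaries of `K`. -/
def simplicialBoundaries (K : PreAbstractSimplicialComplex V) (m : ℕ) :
    Submodule 𝔽 ((Fin (m + 1) → V) →₀ 𝔽) :=
  (simplicialChains 𝔽 K (m + 1)).map (simplicialBoundary 𝔽 V (m + 1))

theorem simplicialBoundary_mem_chains {K : PreAbstractSimplicialComplex V} {m : ℕ}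
    {c : (Fin (m + 1 + 1) → V) →₀ 𝔽} (hc : c ∈ simplicialChains 𝔽 K (m + 1)) :
    simplicialBoundary 𝔽 V (m + 1) c ∈ simplicialChains 𝔽 K m := by
  classical
  obtain ⟨hs, ha⟩ := hc
  refine ⟨fun w hw => ?_, fun σ w => ?_⟩
  · obtain ⟨v, hv, rfl⟩ : ∃ v, c v ≠ 0 ∧ Fin.tail v = w := by
      have h1 : w ∈ (Finsupp.mapDomain Fin.tail c).support := Finsupp.mem_support_iff.2 hw
      obtain ⟨v, hv, hvw⟩ := Finset.mem_image.1 (Finsupp.mapDomain_support h1)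
      exact ⟨v, Finsupp.mem_support_iff.1 hv, hvw⟩
    obtain ⟨hi, s, hsK, hsv⟩ := hs v hv
    refine ⟨hi.comp (Fin.succ_injective _), Finset.univ.image (Fin.tail v), ?_, by simp⟩
    refine (K.isRelLowerSet_faces hsK).2 ?_ (Finset.univ_nonempty.image _)
    intro x hx
    obtain ⟨i, -, rfl⟩ := Finset.mem_image.1 hx
    exact Finset.mem_coe.1 (hsv ▸ ⟨i.succ, rfl⟩)
  · let τ : Equiv.Perm (Fin (m + 1 + 1)) := Equiv.Perm.decomposeFin.symm (0, σ)
    have hτ : Equiv.Perm.sign τ = Equiv.Perm.sign σ := by simp [τ]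
    let e : (Fin (m + 1 + 1) → V) ≃ (Fin (m + 1 + 1) → V) := τ.arrowCongr (Equiv.refl V)
    let e' : (Fin (m + 1) → V) ≃ (Fin (m + 1) → V) := σ.arrowCongr (Equiv.refl V)
    have h1 : Finsupp.mapDomain e c = ((Equiv.Perm.sign σ : ℤ) : 𝔽) • c := by
      ext v
      rw [← hτ, Finsupp.smul_apply, smul_eq_mul, ← ha τ v, Finsupp.mapDomain_equiv_apply]
      rfl
    have h2 : Fin.tail ∘ e = e' ∘ (Fin.tail : (Fin (m + 1 + 1) → V) → _) := by
      funext v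
      funext i
      have h3 : τ.symm i.succ = (σ.symm i).succ := by
        rw [Equiv.symm_apply_eq]
        simp [τ]
      simp [e, e', Fin.tail, Equiv.arrowCongr, h3]
    have h4 : Finsupp.mapDomain e' (Finsupp.mapDomain Fin.tail c) =
        ((Equiv.Perm.sign σ : ℤ) : 𝔽) • Finsupp.mapDomain Fin.tail c := by
      rw [← Finsupp.mapDomain_comp, ← h2, Finsupp.mapDomain_comp, h1, Finsupp.mapDomain_smul]
    have h5 := DFunLike.congr_fun h4 w
    rw [Finsupp.mapDomain_equiv_apply] at h5
    exact h5

theorem simplicialBoundary_comp {K : PreAbstractSimplicialComplex V} {m : ℕ}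
    {c : (Fin (m + 1 + 1) → V) →₀ 𝔽} (hc : c ∈ simplicialChains 𝔽 K (m + 1)) :
    simplicialBoundary 𝔽 V m (simplicialBoundary 𝔽 V (m + 1) c) = 0 := by
  obtain ⟨hs, ha⟩ := hc
  have hsw : ∀ v, c (v ∘ Equiv.swap 0 1) = - c v := fun v => by
    rw [ha, Equiv.Perm.sign_swap (by simp)]
    simp
  change Finsupp.mapDomain Fin.tail (Finsupp.mapDomain Fin.tail c) = 0
  rw [← Finsupp.mapDomain_comp]
  refine Finset.sum_involution (fun v _ => v ∘ Equiv.swap 0 1) ?_ ?_ ?_ ?_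
  · intro v hv
    have h1 : (Fin.tail ∘ Fin.tail) (v ∘ Equiv.swap 0 1) =
        ((Fin.tail ∘ Fin.tail) v : Fin m → V) := by
      funext i
      have : Equiv.swap (0 : Fin (m + 1 + 1)) 1 i.succ.succ = i.succ.succ :=
        Equiv.swap_apply_of_ne_of_ne (by simp) (by simp [Fin.ext_iff])
      simp [Fin.tail, this]
    beta_reduce
    rw [h1, hsw, ← Finsupp.single_add]
    simp
  · intro v hv _ h
    have hi := (hs v (Finsupp.mem_support_iff.1 hv)).1
    have h0 := congrFun h 0
    simp only [Function.comp_apply, Equiv.swap_apply_left] at h0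
    exact absurd (hi h0) (by simp)
  · intro v hv
    rw [Finsupp.mem_support_iff] at hv ⊢
    rwa [hsw, neg_ne_zero]
  · intro v hv
    funext i
    simp

theorem simplicialBoundaries_le_cycles (K : PreAbstractSimplicialComplex V) (m : ℕ) :
    simplicialBoundaries 𝔽 K m ≤ simplicialCycles 𝔽 K m := by
  rintro _ ⟨c, hc, rfl⟩
  unfold simplicialCycles
  split_ifs
  · exact simplicialBoundary_mem_chains 𝔽 hc
  · exact ⟨simplicialBoundary_mem_chains 𝔽 hc, simplicialBoundary_comp 𝔽 hc⟩

/-- Simplicial homology `H_m(K; 𝔽)`: cycles modulo boundaries. -/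
abbrev SimplicialHomology (K : PreAbstractSimplicialComplex V) (m : ℕ) : Type u :=
  Subquotient (simplicialCycles 𝔽 K m) (simplicialBoundaries 𝔽 K m)

theorem simplicialChains_mono {K L : PreAbstractSimplicialComplex V} (h : K ≤ L) (m : ℕ) :
    simplicialChains 𝔽 K m ≤ simplicialChains 𝔽 L m := by
  rintro c ⟨hc, hc'⟩
  refine ⟨fun v hv => ?_, hc'⟩
  obtain ⟨hi, s, hs, hsv⟩ := hc v hv
  exact ⟨hi, s, h hs, hsv⟩

theorem simplicialCycles_mono {K L : PreAbstractSimplicialComplex V} (h : K ≤ L) (m : ℕ) :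
    simplicialCycles 𝔽 K m ≤ simplicialCycles 𝔽 L m := by
  unfold simplicialCycles
  split_ifs
  · exact simplicialChains_mono 𝔽 h m
  · exact inf_le_inf_right _ (simplicialChains_mono 𝔽 h m)

/-- The map on homology induced by an inclusion of complexes. -/
def simplicialHomologyMap {K L : PreAbstractSimplicialComplex V} (h : K ≤ L) (m : ℕ) :
    SimplicialHomology 𝔽 K m →ₗ[𝔽] SimplicialHomology 𝔽 L m :=
  Subquotient.map (simplicialCycles_mono 𝔽 h m)
    (Submodule.map_mono (simplicialChains_mono 𝔽 h (m + 1)))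

/-- `H_m(-; 𝔽)` as a functor on the poset of simplicial complexes with vertices in `V`. -/
def simplicialHomologyFunctor (V : Type) (m : ℕ) :
    PreAbstractSimplicialComplex V ⥤ ModuleCat.{u} 𝔽 where
  obj K := ModuleCat.of 𝔽 (SimplicialHomology 𝔽 K m)
  map f := ModuleCat.ofHom (simplicialHomologyMap 𝔽 f.le m)
  map_id K := by
    ext x
    obtain ⟨x, rfl⟩ := Subquotient.mk_surjective _ _ x
    rfl
  map_comp f g := by
    ext x
    obtain ⟨x, rfl⟩ := Subquotient.mk_surjective _ _ x
    rfl

/-- The persistence module `H_m(F; 𝔽)` of a simplicial filtration `F` over a poset `P`. -/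
def persistentHomology {P : Type} [PartialOrder P]
    (F : P →o PreAbstractSimplicialComplex V) (m : ℕ) : PersistenceModule 𝔽 P :=
  F.monotone.functor ⋙ simplicialHomologyFunctor 𝔽 V m

end Homology

/-! ### Sublevel-Rips and sublevel-Čech bifiltrations -/

/-- The Vietoris–Rips complex at scale `r` of the subspace `S` of a metric space `X`. -/
def ripsComplex {X : Type} [MetricSpace X] (S : Set X) (r : ℝ≥0) :
    PreAbstractSimplicialComplex X where
  faces := {s | s.Nonempty ∧ (s : Set X) ⊆ S ∧ ∀ x ∈ s, ∀ y ∈ s, dist x y ≤ r}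
  isRelLowerSet_faces := by
    rintro s ⟨hs, hS, hr⟩
    exact ⟨hs, fun t hts ht =>
      ⟨ht, fun x hx => hS (hts hx), fun x hx y hy => hr x (hts hx) y (hts hy)⟩⟩

/-- For a subset `X` of a metric space `E` and `S ⊆ X`, the Čech complex of `S` in `E` at
scale `r`: the finite sets of points of `S` whose closed `r`-balls in `E` have a common point. -/
def cechComplex {E : Type} [MetricSpace E] {X : Set E} (S : Set X) (r : ℝ≥0) :
    PreAbstractSimplicialComplex X where
  faces := {s | s.Nonempty ∧ (s : Set X) ⊆ S ∧
    (⋂ x ∈ s, Metric.closedBall (x : E) (r : ℝ)).Nonempty}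
  isRelLowerSet_faces := by
    rintro s ⟨hs, hS, y, hy⟩
    refine ⟨hs, fun t hts ht => ⟨ht, fun x hx => hS (hts hx), y, ?_⟩⟩
    simp only [Set.mem_iInter] at hy ⊢
    exact fun x hx => hy x (hts hx)

/-- The sublevel-Rips bifiltration of `(X, d, γ)` over `ℝ × ℝ≥0`. -/
def sublevelRips {X : Type} [MetricSpace X] (γ : X → ℝ) :
    ℝ × ℝ≥0 →o PreAbstractSimplicialComplex X where
  toFun p := ripsComplex (γ ⁻¹' Set.Iic p.1) p.2
  monotone' := by
    rintro p q hpq s ⟨hs, hS, hr⟩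
    exact ⟨hs, fun x hx => le_trans (hS hx) hpq.1,
      fun x hx y hy => (hr x hx y hy).trans (NNReal.coe_le_coe.2 hpq.2)⟩

/-- The sublevel-Čech bifiltration of `(X, d, γ)` over `ℝ × ℝ≥0`, for `X` a subset of the ambient
metric space `E`. -/
def sublevelCech {E : Type} [MetricSpace E] {X : Set E} (γ : X → ℝ) :
    ℝ × ℝ≥0 →o PreAbstractSimplicialComplex X where
  toFun p := cechComplex (γ ⁻¹' Set.Iic p.1) p.2
  monotone' := by
    rintro p q hpq s ⟨hs, hS, y, hy⟩
    refine ⟨hs, fun x hx => le_trans (hS hx) hpq.1, y, ?_⟩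
    simp only [Set.mem_iInter] at hy ⊢
    exact fun x hx => Metric.closedBall_subset_closedBall (NNReal.coe_le_coe.2 hpq.2) (hy x hx)

/-! ### The super-polynomial module over `[n]²` -/

/-- The filtration over `[n]² = {0, …, n}²` with vertices `z₀, …, z_n` that is empty for
`i + j < n`, consists of the vertices other than `z_i` for `i + j = n`, of all vertices for
`i + j > n`, and is the complete graph at `(n, n)`. -/
def modelFiltration (n : ℕ) :
    Fin (n + 1) × Fin (n + 1) →o PreAbstractSimplicialComplex (Fin (n + 1)) where
  toFun p :=
    { faces := {s | s.Nonempty ∧ n ≤ (p.1 : ℕ) + p.2 ∧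
        ((s.card = 1 ∧ ((p.1 : ℕ) + p.2 = n → p.1 ∉ s)) ∨
          ((p.1 : ℕ) = n ∧ (p.2 : ℕ) = n ∧ s.card ≤ 2))}
      isRelLowerSet_faces := by
        rintro s ⟨hs, hn, h⟩
        refine ⟨hs, fun t hts ht => ⟨ht, hn, ?_⟩⟩
        have h1 : t.card ≤ s.card := Finset.card_le_card hts
        have h2 : 0 < t.card := ht.card_pos
        rcases h with ⟨hc, hp⟩ | ⟨ha, hb, hc⟩
        · exact Or.inl ⟨by omega, fun e hpt => hp e (hts hpt)⟩
        · exact Or.inr ⟨ha, hb, by omega⟩ }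
  monotone' := by
    rintro ⟨a, b⟩ ⟨c, d⟩ ⟨hac, hbd⟩ s ⟨hs, hn, h⟩
    have hac' : (a : ℕ) ≤ c := hac
    have hbd' : (b : ℕ) ≤ d := hbd
    have hc := c.isLt
    have hd := d.isLt
    simp only at hn h
    refine Set.mem_ofPred.2 ⟨hs, by simp only; omega, ?_⟩
    simp only
    rcases h with ⟨h1, hp⟩ | ⟨ha, hb, h2⟩
    · refine Or.inl ⟨h1, fun e => ?_⟩
      have : a = c := Fin.ext (by omega)
      subst this
      exact hp (by omega)
    · exact Or.inr ⟨by omega, by omega, h2⟩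

/-- The module `H_0` of the filtration above. -/
def modelModule (𝔽 : Type u) [Field 𝔽] (n : ℕ) :
    PersistenceModule 𝔽 (Fin (n + 1) × Fin (n + 1)) :=
  persistentHomology 𝔽 (modelFiltration n) 0

/-! ### The witnesses in `ℝ³` with the supremum metric -/

/-- `A = {(1,0), (0,1), (-1,0), (0,-1)}`. -/
def directions : Set (ℝ × ℝ) := {(1, 0), (0, 1), (-1, 0), (0, -1)}

/-- `b_j = n - j / n²`. -/
def witnessRadius (n j : ℕ) : ℝ := (n : ℝ) - (j : ℝ) / (n : ℝ) ^ 2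

/-- The four points `b_j A`, placed in the plane at height `h`. -/
def witnessSquare (n j : ℕ) (h : ℝ) : Set (Fin 3 → ℝ) :=
  {w | ∃ a ∈ directions, w = ![witnessRadius n j * a.1, witnessRadius n j * a.2, h]}

/-- `Y_i`, in the plane `z = 2in`: the union of the squares `b_j A` with `0 ≤ j ≤ n`, `j ≠ i`. -/
def witnessY (n i : ℕ) : Set (Fin 3 → ℝ) :=
  ⋃ j ∈ {j : ℕ | j ≤ n ∧ j ≠ i}, witnessSquare n j (2 * i * n)

/-- `Z_i`, in the plane `z = (2i+1)n`: the square `b_0 A`. -/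
def witnessZ (n i : ℕ) : Set (Fin 3 → ℝ) :=
  witnessSquare n 0 ((2 * i + 1) * n)

/-- `X_n = Y_0 ∪ ⋯ ∪ Y_n ∪ Z_0 ∪ ⋯ ∪ Z_{n-1}`. Here `Fin 3 → ℝ` carries the supremum metric. -/
def witnessSet (n : ℕ) : Set (Fin 3 → ℝ) :=
  (⋃ i ∈ {i : ℕ | i ≤ n}, witnessY n i) ∪ ⋃ i ∈ {i : ℕ | i < n}, witnessZ n i

open Classical in
/-- `γ_n` equals `n` on the sets `Z_i`, and `j` on the points of the sets `Y_i` that project into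
`b_j A`: these have `|x| + |y| = b_j`, so `j = (n - (|x| + |y|)) n²`. -/
def witnessGamma (n : ℕ) (w : witnessSet n) : ℝ :=
  if ∃ i < n, (w : Fin 3 → ℝ) ∈ witnessZ n i then n
  else ((n : ℝ) - (|(w : Fin 3 → ℝ) 0| + |(w : Fin 3 → ℝ) 1|)) * (n : ℝ) ^ 2

theorem witnessGamma_of_mem_Z {n i : ℕ} (hi : i < n) (w : witnessSet n)
    (hw : (w : Fin 3 → ℝ) ∈ witnessZ n i) : witnessGamma n w = n :=
  if_pos ⟨i, hi, hw⟩

theorem witnessGamma_of_mem_Y {n i j : ℕ} (hn : 2 ≤ n) (hj : j ≤ n) (w : witnessSet n)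
    (hw : (w : Fin 3 → ℝ) ∈ witnessSquare n j (2 * i * n)) : witnessGamma n w = j := by
  have hn' : (2 : ℝ) ≤ n := by exact_mod_cast hn
  have hj' : (j : ℝ) ≤ n := by exact_mod_cast hj
  have hb : 0 ≤ witnessRadius n j := by
    unfold witnessRadius
    rw [sub_nonneg, div_le_iff₀ (by positivity)]
    nlinarith [pow_le_pow_left₀ (by norm_num) hn' 2]
  obtain ⟨a, ha, hwa⟩ := hw
  rw [witnessGamma, if_neg]
  · have hs : |(w : Fin 3 → ℝ) 0| + |(w : Fin 3 → ℝ) 1| = witnessRadius n j := by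
      rw [hwa]
      rcases ha with rfl | rfl | rfl | rfl <;> simp [abs_of_nonneg hb]
    rw [hs, witnessRadius]
    field_simp
    ring
  · rintro ⟨k, -, a', -, hwa'⟩
    have h2 : (2 * i * n : ℝ) = (2 * k + 1) * n := by
      have := congrFun (hwa.symm.trans hwa') 2
      simpa using this
    have h3 : (2 * i : ℝ) = 2 * k + 1 := mul_right_cancel₀ (by positivity) h2
    have h4 : 2 * i = 2 * k + 1 := by exact_mod_cast h3
    omega

/-- The embedding `(i, j) ↦ (i, s β_j)` of the grid `[n]²` in `ℝ × ℝ≥0`, where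
`β_j = b_{n-j} = n - (n - j) / n²`, so that `{β_0 < ⋯ < β_n} = {b_n < ⋯ < b_0}`. -/
def gridEmbedding (n : ℕ) (s : ℝ≥0) : Fin (n + 1) × Fin (n + 1) →o ℝ × ℝ≥0 where
  toFun p := ((p.1 : ℕ), s * (witnessRadius n (n - p.2)).toNNReal)
  monotone' := by
    rintro ⟨a, b⟩ ⟨c, d⟩ ⟨hac, hbd⟩
    have hac' : (a : ℕ) ≤ c := hac
    have hbd' : n - (d : ℕ) ≤ n - b := Nat.sub_le_sub_left hbd n
    refine ⟨by simpa using hac', mul_le_mul_right (Real.toNNReal_le_toNNReal ?_) _⟩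
    unfold witnessRadius
    gcongr

end

/-! ### The limit-to-colimit rank -/

/-! Write `E = {0, …, n}` and, for `S ⊆ E`, let `I_S` be the part of the grid strictly above the
antidiagonal together with the points `(i, n - i)`, `i ∈ S`. Below the top the model module has no
boundaries, so a section over `I_S` is one vector of `𝔽^E` whose coordinate `z_i` vanishes for every
`i ∈ S`. The colimit over `I_S` is the value `𝔽` at `(n, n)`, reached by the augmentation. Hence the
rank over `I_S` is `1` for `S ≠ E` and `0` for `S = E` (`generalizedRank_modelModule`).

An interval `J ⊇ I_∅` contains `I_S` exactly when its trace `{i | (i, n - i) ∈ J}` contains `S`.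
Summing a diagram over the intervals of each trace `T` gives `h(T)` with `∑_{T ⊇ S} h(T) = 1 - [S =
E]`. Möbius inversion on subsets yields `h(S) = [S = E] - (-1)^{|E ∖ S|}`, which is nonzero for all
`2^{n+1} - 1` proper `S`, so each of them is the trace of an interval in the support
(`IsGPD.two_pow_sub_one_le_encard_support`). The argument passes to `ℝ × ℝ≥0` through convex hulls
of the images of the `I_S`: the grid embedding preserves joins, so the inclusion into the hull is
initial and final and ranks are unchanged (`generalizedRank_hullInterval`).

In the witness, perpendicular points of a plane become adjacent once the scale reaches both radii,
and opposite points never do. So at `(i, β_j)` the set `Y_k` carries a 4-cycle exactly when some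
index `ℓ ≠ k` satisfies `n - j ≤ ℓ ≤ i`: never if `i + j < n`, for all `k ≠ i` if `i + j = n`, for
all `k` if `i + j > n`. Planes get linked only at `(n, n)`, where the `Z_i` are present and the
scale is `n`. Winding numbers, counted on edges from direction `0` to direction `1`, turn this into
an isomorphism with the model module (`WitnessLabel.homologyIso`). The Čech case reduces to Rips,
since for the supremum metric the Čech complex at `r / 2` is the Rips complex at `r`.

Existence and finiteness hold because a bifiltration of a finite set is pulled back from a finite
grid along a surjective product of monotone maps. Taking images of intervals preserves generalized
ranks, so a diagram over the finite grid transports along preimages (`hasFiniteGPD_comap_prodMap`).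
-/

section Rank

variable {𝔽 : Type u} [Field 𝔽]

/-- The rank of the map from the limit to the colimit of `F` through the object at `j`. -/
noncomputable def limitColimitRank {J : Type} [Preorder J] (F : J ⥤ ModuleCat.{u} 𝔽) (j : J) : ℕ :=
  Module.finrank 𝔽 (LinearMap.range (limit.π F j ≫ colimit.ι F j).hom)

theorem finrank_range_iso_comp_iso {A B C D : ModuleCat.{u} 𝔽} (e : A ≅ B) (f : B ⟶ C)
    (e' : C ≅ D) :
    Module.finrank 𝔽 (LinearMap.range (e.hom ≫ f ≫ e'.hom).hom) =
      Module.finrank 𝔽 (LinearMap.range f.hom) := by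
  have h1 : (e.hom ≫ f ≫ e'.hom).hom = (e'.toLinearEquiv.toLinearMap ∘ₗ f.hom) ∘ₗ
      e.toLinearEquiv.toLinearMap := rfl
  rw [h1, LinearMap.range_comp_of_range_eq_top _ (LinearEquiv.range _), LinearMap.range_comp]
  exact LinearEquiv.finrank_map_eq _ _

/-- Any two elements of `S` are joined by a zigzag of comparable elements of `S`. -/
def IsZigzagConnected {P : Type} [Preorder P] (S : Set P) : Prop :=
  ∀ p q : S, Relation.ReflTransGen (fun x y : S => x ≤ y ∨ y ≤ x) p q

theorem zigzag_map {P Q : Type} [Preorder P] [Preorder Q] {g : P → Q} (hg : Monotone g) {p q : P}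
    (h : Relation.ReflTransGen (fun x y : P => x ≤ y ∨ y ≤ x) p q) :
    Relation.ReflTransGen (fun x y : Q => x ≤ y ∨ y ≤ x) (g p) (g q) := by
  induction h with
  | refl => exact Relation.ReflTransGen.refl
  | tail _ h ih => exact ih.tail (h.imp (fun h => hg h) (fun h => hg h))

theorem limitColimitRank_eq_of_le {J : Type} [Preorder J] (F : J ⥤ ModuleCat.{u} 𝔽) {i j : J}
    (h : i ≤ j) : limitColimitRank F i = limitColimitRank F j := by
  have h1 : limit.π F i ≫ colimit.ι F i = limit.π F j ≫ colimit.ι F j := by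
    rw [← limit.w F (homOfLE h), Category.assoc, colimit.w]
  rw [limitColimitRank, limitColimitRank, h1]

theorem limitColimitRank_eq {J : Type} [Preorder J] (F : J ⥤ ModuleCat.{u} 𝔽) {i j : J}
    (h : Relation.ReflTransGen (fun x y : J => x ≤ y ∨ y ≤ x) i j) :
    limitColimitRank F i = limitColimitRank F j := by
  induction h with
  | refl => rfl
  | tail _ h ih =>
    rcases h with h | h
    · rw [ih, limitColimitRank_eq_of_le F h]
    · rw [ih, limitColimitRank_eq_of_le F h]

theorem limitColimitRank_congr {J : Type} [Preorder J] {F G : J ⥤ ModuleCat.{u} 𝔽} (e : F ≅ G)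
    (j : J) : limitColimitRank F j = limitColimitRank G j := by
  have h1 : limit.π F j ≫ colimit.ι F j = (HasLimit.isoOfNatIso e).hom ≫
      (limit.π G j ≫ colimit.ι G j) ≫ (HasColimit.isoOfNatIso e).symm.hom := by
    simp
  rw [limitColimitRank, h1, finrank_range_iso_comp_iso, limitColimitRank]

/-- Over a preorder the structured arrows from `k` are just the elements `j` with `k ≤ g j`, so
finality is nonemptiness and zigzag connectedness of these subsets. -/
theorem final_of_isZigzagConnected {J K : Type} [Preorder J] [Preorder K] {g : J → K}
    (hg : Monotone g) (hne : ∀ k, ∃ j, k ≤ g j)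
    (hc : ∀ k, IsZigzagConnected {j | k ≤ g j}) : hg.functor.Final := by
  refine ⟨fun k => ?_⟩
  have : Nonempty (StructuredArrow k hg.functor) := by
    obtain ⟨j, hj⟩ := hne k
    exact ⟨StructuredArrow.mk (Y := j) (homOfLE hj)⟩
  let mk : {j | k ≤ g j} → StructuredArrow k hg.functor := fun j =>
    StructuredArrow.mk (Y := j.1) (homOfLE j.2)
  have hz : ∀ p q : {j | k ≤ g j}, Zigzag (mk p) (mk q) := fun p q => by
    induction hc k p q with
    | refl => exact Zigzag.refl _
    | tail _ h ih =>
      rcases h with h | h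
      · exact ih.trans (Zigzag.of_hom (StructuredArrow.homMk (homOfLE h)))
      · exact ih.trans (Zigzag.of_inv (StructuredArrow.homMk (homOfLE h)))
  refine zigzag_isConnected fun a b => ?_
  exact hz ⟨a.right, leOfHom a.hom⟩ ⟨b.right, leOfHom b.hom⟩

theorem initial_of_isZigzagConnected {J K : Type} [Preorder J] [Preorder K] {g : J → K}
    (hg : Monotone g) (hne : ∀ k, ∃ j, g j ≤ k)
    (hc : ∀ k, IsZigzagConnected {j | g j ≤ k}) : hg.functor.Initial := by
  refine ⟨fun k => ?_⟩
  have : Nonempty (CostructuredArrow hg.functor k) := by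
    obtain ⟨j, hj⟩ := hne k
    exact ⟨CostructuredArrow.mk (Y := j) (homOfLE hj)⟩
  let mk : {j | g j ≤ k} → CostructuredArrow hg.functor k := fun j =>
    CostructuredArrow.mk (Y := j.1) (homOfLE j.2)
  have hz : ∀ p q : {j | g j ≤ k}, Zigzag (mk p) (mk q) := fun p q => by
    induction hc k p q with
    | refl => exact Zigzag.refl _
    | tail _ h ih =>
      rcases h with h | h
      · exact ih.trans (Zigzag.of_hom (CostructuredArrow.homMk (homOfLE h)))
      · exact ih.trans (Zigzag.of_inv (CostructuredArrow.homMk (homOfLE h)))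
  refine zigzag_isConnected fun a b => ?_
  exact hz ⟨a.left, leOfHom a.hom⟩ ⟨b.left, leOfHom b.hom⟩

theorem limitColimitRank_comp {J K : Type} [Preorder J] [Preorder K] (G : J ⥤ K) [G.Initial]
    [G.Final] (F : K ⥤ ModuleCat.{u} 𝔽) (j : J) :
    limitColimitRank (G ⋙ F) j = limitColimitRank F (G.obj j) := by
  have h1 : limit.π F (G.obj j) ≫ colimit.ι F (G.obj j) =
      (asIso (limit.pre F G)).hom ≫ (limit.π (G ⋙ F) j ≫ colimit.ι (G ⋙ F) j) ≫
        (asIso (colimit.pre F G)).hom := by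
    simp [colimit.ι_pre]
  rw [limitColimitRank, limitColimitRank, h1, finrank_range_iso_comp_iso]

theorem generalizedRank_eq {P : Type} [PartialOrder P] (M : PersistenceModule 𝔽 P)
    (I : PosetInterval P) (p : I.carrier) :
    generalizedRank M I = limitColimitRank (M.restrict I.carrier) p :=
  limitColimitRank_eq _ (I.connected _ _)

theorem generalizedRank_congr {P : Type} [PartialOrder P] {M N : PersistenceModule 𝔽 P}
    (e : M ≅ N) (I : PosetInterval P) : generalizedRank M I = generalizedRank N I :=
  limitColimitRank_congr (Functor.isoWhiskerLeft _ e) _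

/-- If `g : P → Q` maps the interval `I` to the interval `K` and the restriction `I → K` is
initial and final, then the generalized rank over `I` of the pullback along `g` is the generalized
rank over `K`. -/
theorem generalizedRank_comap {P Q : Type} [PartialOrder P] [PartialOrder Q]
    (N : PersistenceModule 𝔽 Q) (g : P →o Q) (I : PosetInterval P) (K : PosetInterval Q)
    (hIK : ∀ p ∈ I.carrier, g p ∈ K.carrier)
    (hup : ∀ k ∈ K.carrier, {p | p ∈ I.carrier ∧ k ≤ g p}.Nonempty)
    (hupc : ∀ k ∈ K.carrier, IsZigzagConnected {p | p ∈ I.carrier ∧ k ≤ g p})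
    (hdn : ∀ k ∈ K.carrier, {p | p ∈ I.carrier ∧ g p ≤ k}.Nonempty)
    (hdnc : ∀ k ∈ K.carrier, IsZigzagConnected {p | p ∈ I.carrier ∧ g p ≤ k}) :
    generalizedRank (N.comap g) I = generalizedRank N K := by
  let g' : I.carrier → K.carrier := fun p => ⟨g p, hIK p p.2⟩
  have hg' : Monotone g' := fun p q h => g.monotone h
  have hfin : hg'.functor.Final := by
    refine final_of_isZigzagConnected hg' (fun k => ?_) (fun k p q => ?_)
    · obtain ⟨p, hp, hk⟩ := hup k k.2
      exact ⟨⟨p, hp⟩, hk⟩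
    · exact zigzag_map (g := fun x : {p | p ∈ I.carrier ∧ k.1 ≤ g p} =>
        (⟨⟨x.1, x.2.1⟩, x.2.2⟩ : {p | k ≤ g' p}))
        (fun x y h => h) (hupc k k.2 ⟨p.1, p.1.2, p.2⟩ ⟨q.1, q.1.2, q.2⟩)
  have hini : hg'.functor.Initial := by
    refine initial_of_isZigzagConnected hg' (fun k => ?_) (fun k p q => ?_)
    · obtain ⟨p, hp, hk⟩ := hdn k k.2
      exact ⟨⟨p, hp⟩, hk⟩
    · exact zigzag_map (g := fun x : {p | p ∈ I.carrier ∧ g p ≤ k.1} =>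
        (⟨⟨x.1, x.2.1⟩, x.2.2⟩ : {p | g' p ≤ k}))
        (fun x y h => h) (hdnc k k.2 ⟨p.1, p.1.2, p.2⟩ ⟨q.1, q.1.2, q.2⟩)
  obtain ⟨p, hp⟩ := I.nonempty
  rw [generalizedRank_eq _ I ⟨p, hp⟩, generalizedRank_eq _ K (g' ⟨p, hp⟩)]
  exact limitColimitRank_comp hg'.functor (N.restrict K.carrier) ⟨p, hp⟩

end Rank

/-! ### Existence and uniqueness of generalized persistence diagrams -/

theorem PosetInterval.carrier_injective {P : Type} [PartialOrder P] :
    Function.Injective (PosetInterval.carrier : PosetInterval P → Set P) := by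
  rintro ⟨I, _, _, _⟩ ⟨J, _, _, _⟩ h
  cases h
  rfl

section Diagram

variable {𝔽 : Type u} [Field 𝔽]

/-- Only finitely many intervals above a given one carry different values of the two functions, so
there is a maximal such `K`. In the two expressions for the rank over `K` all terms other than the
one at `K` agree and cancel. No finiteness of the poset is needed. -/
theorem IsGPD.unique {P : Type} [PartialOrder P] {M : PersistenceModule 𝔽 P}
    {f f' : PosetInterval P → ℤ} (hf : IsGPD M f) (hf' : IsGPD M f') : f = f' := by
  by_contra hne
  obtain ⟨J, hJ⟩ := Function.ne_iff.1 hne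
  let s : Set (PosetInterval P) := {K | J.carrier ⊆ K.carrier ∧ f K ≠ f' K}
  have hs : s.Finite := by
    refine ((hf J).1.union (hf' J).1).subset ?_
    rintro K ⟨hK, hK'⟩
    by_cases h : f K = 0
    · exact Or.inr ⟨hK, fun h' => hK' (h.trans h'.symm)⟩
    · exact Or.inl ⟨hK, h⟩
  obtain ⟨K, ⟨hKs, hKne⟩, hKmax⟩ := hs.exists_maximalFor PosetInterval.carrier s
    ⟨J, subset_rfl, hJ⟩
  have h0 : ∀ L : PosetInterval P, K.carrier ⊆ L.carrier → L ≠ K → f L = f' L := by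
    intro L hL hLK
    by_contra h
    exact hLK (PosetInterval.carrier_injective
      (Set.Subset.antisymm (hKmax ⟨hKs.trans hL, h⟩ hL) hL))
  have key : ∀ h : PosetInterval P → ℤ, IsGPD M h →
      (generalizedRank M K : ℤ) =
        h K + ∑ᶠ (L) (_ : L ∈ {L : PosetInterval P | K.carrier ⊆ L.carrier ∧ L ≠ K}), h L := by
    intro h hh
    have h1 : {L : PosetInterval P | K.carrier ⊆ L.carrier} =
        insert K {L : PosetInterval P | K.carrier ⊆ L.carrier ∧ L ≠ K} := by
      ext L
      by_cases hL : L = K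
      · simp [hL]
      · simp [hL]
    rw [(hh K).2]
    change ∑ᶠ (L) (_ : L ∈ {L : PosetInterval P | K.carrier ⊆ L.carrier}), h L = _
    rw [h1, finsum_mem_insert' _ (by simp)]
    exact (hh K).1.subset fun L hL => ⟨hL.1.1, hL.2⟩
  have h1 := (key f hf).symm.trans (key f' hf')
  rw [finsum_mem_congr rfl (fun L hL => h0 L hL.1 hL.2)] at h1
  exact hKne (add_right_cancel h1)

theorem IsGPD.gpd_eq {P : Type} [PartialOrder P] {M : PersistenceModule 𝔽 P}
    {f : PosetInterval P → ℤ} (hf : IsGPD M f) : gpd M = f :=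
  (Classical.epsilon_spec (p := IsGPD M) ⟨f, hf⟩).unique hf

theorem IsGPD.hasFiniteGPD {P : Type} [PartialOrder P] {M : PersistenceModule 𝔽 P}
    {f : PosetInterval P → ℤ} (hf : IsGPD M f) (hs : (Function.support f).Finite) :
    HasFiniteGPD M :=
  ⟨⟨f, hf, fun _ h => h.unique hf⟩, hf.gpd_eq ▸ hs⟩

theorem HasFiniteGPD.isGPD {P : Type} [PartialOrder P] {M : PersistenceModule 𝔽 P}
    (h : HasFiniteGPD M) : IsGPD M (gpd M) :=
  Classical.epsilon_spec h.1.exists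

/-- Möbius inversion on a finite partial order. -/
theorem exists_sum_Ici_eq {ι : Type} [Finite ι] [PartialOrder ι] (r : ι → ℤ) :
    ∃ g : ι → ℤ, ∀ x, r x = ∑ᶠ (y) (_ : x ≤ y), g y := by
  classical
  have wf : WellFounded (fun x y : ι => y < x) := (Finite.to_wellFoundedGT).wf
  -- Recursion from the top down: the value at `x` corrects `r x` by the values strictly above `x`.
  let g : ι → ℤ := wf.fix fun x ih => r x - ∑ᶠ (y : {y // x < y}), ih y.1 y.2
  have hg : ∀ x, g x = r x - ∑ᶠ (y : {y // x < y}), g y := fun x => wf.fix_eq _ x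
  refine ⟨g, fun x => ?_⟩
  have h1 : {y | x ≤ y} = insert x {y | x < y} := by
    ext y
    simp [le_iff_lt_or_eq, or_comm, eq_comm]
  change _ = ∑ᶠ (y) (_ : y ∈ {y | x ≤ y}), g y
  have h2 : ∑ᶠ (y : {y // x < y}), g y = ∑ᶠ (y) (_ : y ∈ {y | x < y}), g y :=
    finsum_subtype_eq_finsum_cond _
  rw [h1, finsum_mem_insert _ (by simp) (Set.toFinite _), hg x, h2, sub_add_cancel]

theorem exists_isGPD_of_finite {P : Type} [PartialOrder P] [Finite P]
    (M : PersistenceModule 𝔽 P) : ∃ f, IsGPD M f := by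
  have : Finite (PosetInterval P) := Finite.of_injective _ PosetInterval.carrier_injective
  let _ : PartialOrder (PosetInterval P) :=
    PartialOrder.lift _ PosetInterval.carrier_injective
  obtain ⟨g, hg⟩ := exists_sum_Ici_eq (fun I : PosetInterval P => (generalizedRank M I : ℤ))
  exact ⟨g, fun I => ⟨Set.toFinite _, hg I⟩⟩

theorem hasFiniteGPD_of_finite {P : Type} [PartialOrder P] [Finite P]
    (M : PersistenceModule 𝔽 P) : HasFiniteGPD M := by
  have : Finite (PosetInterval P) := Finite.of_injective _ PosetInterval.carrier_injective
  obtain ⟨f, hf⟩ := exists_isGPD_of_finite M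
  exact hf.hasFiniteGPD (Set.toFinite _)

/-! ### Pullbacks along floor maps of grids -/

section Grid

variable {α β A B : Type} [LinearOrder α] [LinearOrder β] [LinearOrder A] [LinearOrder B]

/-- In each coordinate, clamping `x` to the box spanned by `p` and `q` gives the median of the three
entries. With three points and two coordinates, one of the points lies below the medians in both
coordinates, and dually one lies above. -/
theorem clamp_between (p q x : α × β) :
    (p ≤ p ⊓ q ⊔ x ⊓ (p ⊔ q) ∨ q ≤ p ⊓ q ⊔ x ⊓ (p ⊔ q) ∨ x ≤ p ⊓ q ⊔ x ⊓ (p ⊔ q)) ∧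
    (p ⊓ q ⊔ x ⊓ (p ⊔ q) ≤ p ∨ p ⊓ q ⊔ x ⊓ (p ⊔ q) ≤ q ∨ p ⊓ q ⊔ x ⊓ (p ⊔ q) ≤ x) := by
  obtain ⟨p1, p2⟩ := p
  obtain ⟨q1, q2⟩ := q
  obtain ⟨x1, x2⟩ := x
  simp only [Prod.mk_inf_mk, Prod.mk_sup_mk, Prod.mk_le_mk]
  grind

/-- In a product of two chains, an interval meets every convex sublattice in a connected set. -/
theorem PosetInterval.isZigzagConnected_inter (I : PosetInterval (α × β)) {U : Set (α × β)}
    (hU : ∀ p ∈ U, ∀ q ∈ U, Set.Icc (p ⊓ q) (p ⊔ q) ⊆ U) :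
    IsZigzagConnected {p | p ∈ I.carrier ∧ p ∈ U} := by
  rintro ⟨p, hpI, hpU⟩ ⟨q, hqI, hqU⟩
  have hI : ∀ x ∈ I.carrier, p ⊓ q ⊔ x ⊓ (p ⊔ q) ∈ I.carrier := by
    intro x hx
    have : ∃ y ∈ I.carrier, ∃ z ∈ I.carrier, p ⊓ q ⊔ x ⊓ (p ⊔ q) ∈ Set.Icc y z := by
      obtain ⟨h1 | h1 | h1, h2 | h2 | h2⟩ := clamp_between p q x
      all_goals exact ⟨_, by assumption, _, by assumption, h1, h2⟩
    obtain ⟨y, hy, z, hz, h⟩ := this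
    exact I.convex.out hy hz h
  have hUx : ∀ x, p ⊓ q ⊔ x ⊓ (p ⊔ q) ∈ U := fun x =>
    hU p hpU q hqU ⟨le_sup_left, sup_le (inf_le_left.trans le_sup_left) inf_le_right⟩
  -- Clamping to the box is monotone and fixes `p` and `q`, so it moves a zigzag from `p` to `q` in
  -- `I` into the box, hence into `U`.
  let c : I.carrier → {p | p ∈ I.carrier ∧ p ∈ U} := fun x =>
    ⟨p ⊓ q ⊔ x ⊓ (p ⊔ q), hI x x.2, hUx x⟩
  have hc : Monotone c := fun x y h => by
    change p ⊓ q ⊔ x ⊓ (p ⊔ q) ≤ p ⊓ q ⊔ y ⊓ (p ⊔ q)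
    exact sup_le_sup_left (inf_le_inf_right _ h) _
  have h := zigzag_map hc (I.connected ⟨p, hpI⟩ ⟨q, hqI⟩)
  have hp : c ⟨p, hpI⟩ = ⟨p, hpI, hpU⟩ := Subtype.ext (by simp [c])
  have hq : c ⟨q, hqI⟩ = ⟨q, hqI, hqU⟩ := Subtype.ext (by simp [c])
  rwa [hp, hq] at h

variable (g₁ : α →o A) (g₂ : β →o B)

theorem prodMap_sup (p q : α × β) :
    g₁.prodMap g₂ (p ⊔ q) = g₁.prodMap g₂ p ⊔ g₁.prodMap g₂ q :=
  Prod.ext (g₁.monotone.map_sup _ _) (g₂.monotone.map_sup _ _)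

theorem prodMap_inf (p q : α × β) :
    g₁.prodMap g₂ (p ⊓ q) = g₁.prodMap g₂ p ⊓ g₁.prodMap g₂ q :=
  Prod.ext (g₁.monotone.map_inf _ _) (g₂.monotone.map_inf _ _)

variable {g₁ g₂}

theorem prodMap_surjective (h₁ : Function.Surjective g₁) (h₂ : Function.Surjective g₂) :
    Function.Surjective (g₁.prodMap g₂) :=
  Function.Surjective.prodMap h₁ h₂

/-- The image of an interval under a surjective product of two monotone maps of chains. -/
def PosetInterval.image (I : PosetInterval (α × β)) (h₁ : Function.Surjective g₁)
    (h₂ : Function.Surjective g₂) : PosetInterval (A × B) where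
  carrier := g₁.prodMap g₂ '' I.carrier
  nonempty := I.nonempty.image _
  convex := by
    refine ⟨?_⟩
    rintro _ ⟨p, hp, rfl⟩ _ ⟨q, hq, rfl⟩ x ⟨hx1, hx2⟩
    obtain ⟨y, rfl⟩ := prodMap_surjective h₁ h₂ x
    have key : ∀ p ∈ I.carrier, ∀ q ∈ I.carrier, p ≤ q → g₁.prodMap g₂ p ≤ g₁.prodMap g₂ y →
        g₁.prodMap g₂ y ≤ g₁.prodMap g₂ q → g₁.prodMap g₂ y ∈ g₁.prodMap g₂ '' I.carrier := by
      intro p hp q hq h h1 h2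
      -- Clamping `y` between `p` and `q` puts it into `I` without changing its image.
      refine ⟨p ⊔ y ⊓ q, I.convex.out hp hq ⟨le_sup_left, sup_le h inf_le_right⟩, ?_⟩
      rw [prodMap_sup, prodMap_inf, inf_eq_left.2 h2, sup_eq_right.2 h1]
    by_cases h : p ≤ q
    · exact key p hp q hq h hx1 hx2
    -- If `p ≤ q` fails, one coordinate of `p` exceeds that of `q`; as the images satisfy the
    -- opposite inequality, that coordinate is constant on the images of `U`. These images therefore
    -- lie in a chain through the target point, and a zigzag in `I ∩ U` from `p` to `q` either ends
    -- at that point or passes it at an ascending step, where `key` applies.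
    · have hch : ∀ x : α × β, g₁.prodMap g₂ p ≤ g₁.prodMap g₂ x →
          g₁.prodMap g₂ x ≤ g₁.prodMap g₂ q → g₁.prodMap g₂ x ≤ g₁.prodMap g₂ y ∨
            g₁.prodMap g₂ y ≤ g₁.prodMap g₂ x := by
        intro x h3 h4
        obtain ⟨h31, h32⟩ := h3
        obtain ⟨h41, h42⟩ := h4
        obtain ⟨h51, h52⟩ := hx1
        obtain ⟨h61, h62⟩ := hx2
        rcases not_and_or.1 h with h | h
        · have h7 := g₁.monotone (not_le.1 h).le
          exact (le_total (g₂ x.2) (g₂ y.2)).imp (fun h8 => ⟨h41.trans (h7.trans h51), h8⟩)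
            (fun h8 => ⟨h61.trans (h7.trans h31), h8⟩)
        · have h7 := g₂.monotone (not_le.1 h).le
          exact (le_total (g₁ x.1) (g₁ y.1)).imp (fun h8 => ⟨h8, h42.trans (h7.trans h52)⟩)
            (fun h8 => ⟨h8, h62.trans (h7.trans h32)⟩)
      let U : Set (α × β) := {x | g₁.prodMap g₂ p ≤ g₁.prodMap g₂ x ∧
        g₁.prodMap g₂ x ≤ g₁.prodMap g₂ q}
      have hU : ∀ a ∈ U, ∀ b ∈ U, Set.Icc (a ⊓ b) (a ⊔ b) ⊆ U := by
        rintro a ⟨ha1, ha2⟩ b ⟨hb1, hb2⟩ x ⟨hx1, hx2⟩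
        refine ⟨(le_inf ha1 hb1).trans ?_, le_trans ?_ (sup_le ha2 hb2)⟩
        · rw [← prodMap_inf]
          exact (g₁.prodMap g₂).monotone hx1
        · rw [← prodMap_sup]
          exact (g₁.prodMap g₂).monotone hx2
      have hpath : ∀ x : {x | x ∈ I.carrier ∧ x ∈ U}, Relation.ReflTransGen
          (fun x y : {x | x ∈ I.carrier ∧ x ∈ U} => x ≤ y ∨ y ≤ x)
          ⟨p, hp, le_rfl, hx1.trans hx2⟩ x →
          g₁.prodMap g₂ x ≤ g₁.prodMap g₂ y ∨
            g₁.prodMap g₂ y ∈ g₁.prodMap g₂ '' I.carrier := by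
        intro x hx
        induction hx with
        | refl => exact Or.inl hx1
        | @tail x x' _ h ih =>
          rcases ih with ih | ih
          · rcases h with h | h
            · rcases hch x' x'.2.2.1 x'.2.2.2 with h' | h'
              · exact Or.inl h'
              · exact Or.inr (key x x.2.1 x' x'.2.1 h ih h')
            · exact Or.inl (((g₁.prodMap g₂).monotone h).trans ih)
          · exact Or.inr ih
      rcases hpath _ (I.isZigzagConnected_inter hU _ ⟨q, hq, hx1.trans hx2, le_rfl⟩) with h | h
      · exact ⟨q, hq, le_antisymm h hx2⟩
      · exact h
  connected := by
    rintro ⟨_, p, hp, rfl⟩ ⟨_, q, hq, rfl⟩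
    let c : I.carrier → g₁.prodMap g₂ '' I.carrier := fun x => ⟨_, x, x.2, rfl⟩
    have hc : Monotone c := fun x y h => (g₁.prodMap g₂).monotone h
    exact zigzag_map hc (I.connected ⟨p, hp⟩ ⟨q, hq⟩)

/-- The preimage of an interval under a surjective product of two monotone maps of chains. -/
def PosetInterval.preimage (K : PosetInterval (A × B)) (h₁ : Function.Surjective g₁)
    (h₂ : Function.Surjective g₂) : PosetInterval (α × β) where
  carrier := g₁.prodMap g₂ ⁻¹' K.carrier
  nonempty := K.nonempty.preimage (prodMap_surjective h₁ h₂)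
  convex := K.convex.preimage_mono (g₁.prodMap g₂).monotone
  connected := by
    have key : ∀ k k' : K.carrier,
        Relation.ReflTransGen (fun x y : K.carrier => x ≤ y ∨ y ≤ x) k k' →
        ∀ p q : g₁.prodMap g₂ ⁻¹' K.carrier, g₁.prodMap g₂ p = k → g₁.prodMap g₂ q = k' →
        Relation.ReflTransGen (fun x y : g₁.prodMap g₂ ⁻¹' K.carrier => x ≤ y ∨ y ≤ x) p q := by
      -- Points with comparable images need not be comparable, but both lie below `p ⊔ q`, whose
      -- image is that of `q`.
      have h0 : ∀ p q : g₁.prodMap g₂ ⁻¹' K.carrier, g₁.prodMap g₂ p ≤ g₁.prodMap g₂ q →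
          Relation.ReflTransGen (fun x y : g₁.prodMap g₂ ⁻¹' K.carrier => x ≤ y ∨ y ≤ x) p q := by
        intro p q h
        have h1 : g₁.prodMap g₂ (p ⊔ q : α × β) = g₁.prodMap g₂ q := by
          rw [prodMap_sup, sup_eq_right.2 h]
        let z : g₁.prodMap g₂ ⁻¹' K.carrier := ⟨p ⊔ q, by
          rw [Set.mem_preimage, h1]
          exact q.2⟩
        have hpz : p ≤ z := le_sup_left (a := (p : α × β))
        have hqz : q ≤ z := le_sup_right (a := (p : α × β))
        exact Relation.ReflTransGen.tail (b := z) (Relation.ReflTransGen.single (Or.inl hpz))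
          (Or.inr hqz)
      have h0' : ∀ p q : g₁.prodMap g₂ ⁻¹' K.carrier, g₁.prodMap g₂ q ≤ g₁.prodMap g₂ p →
          Relation.ReflTransGen (fun x y : g₁.prodMap g₂ ⁻¹' K.carrier => x ≤ y ∨ y ≤ x) p q := by
        intro p q h
        have : Std.Symm (fun x y : g₁.prodMap g₂ ⁻¹' K.carrier => x ≤ y ∨ y ≤ x) :=
          ⟨fun x y h => h.symm⟩
        exact Relation.ReflTransGen.stdSymm.symm _ _ (h0 q p h)
      intro k k' h
      induction h with
      | refl => exact fun p q hp hq => h0 p q (hp.trans hq.symm).le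
      | @tail x x' _ h ih =>
        intro p q hp hq
        obtain ⟨y, hy⟩ := prodMap_surjective h₁ h₂ x
        have hy' : y ∈ g₁.prodMap g₂ ⁻¹' K.carrier := by
          rw [Set.mem_preimage, hy]
          exact x.2
        refine (ih p ⟨y, hy'⟩ hp hy).trans ?_
        rcases h with h | h
        · exact h0 _ _ (by rw [hq]; exact hy.le.trans h)
        · exact h0' _ _ (by rw [hq]; exact le_trans h hy.ge)
    exact fun p q => key ⟨_, p.2⟩ ⟨_, q.2⟩ (K.connected _ _) p q rfl rfl

/-- Since `g₁.prodMap g₂` preserves meets and joins, the fibres `{p | k ≤ g p}` and `{p | g p ≤ k}`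
contain the box spanned by any two of their points. They therefore meet `I` in connected sets, and
`I` maps to its image by an initial and final functor. -/
theorem generalizedRank_comap_prodMap (N : PersistenceModule 𝔽 (A × B))
    (h₁ : Function.Surjective g₁) (h₂ : Function.Surjective g₂) (I : PosetInterval (α × β)) :
    generalizedRank (N.comap (g₁.prodMap g₂)) I = generalizedRank N (I.image h₁ h₂) := by
  refine generalizedRank_comap N _ I _ (fun p hp => ⟨p, hp, rfl⟩) ?_ ?_ ?_ ?_
  · rintro _ ⟨p, hp, rfl⟩
    exact ⟨p, hp, le_rfl⟩
  · intro k _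
    refine I.isZigzagConnected_inter (U := {p | k ≤ g₁.prodMap g₂ p}) fun p hp q hq x hx => ?_
    refine le_trans (le_inf (Set.mem_ofPred.1 hp) (Set.mem_ofPred.1 hq)) ?_
    rw [← prodMap_inf]
    exact (g₁.prodMap g₂).monotone hx.1
  · rintro _ ⟨p, hp, rfl⟩
    exact ⟨p, hp, le_rfl⟩
  · intro k _
    refine I.isZigzagConnected_inter (U := {p | g₁.prodMap g₂ p ≤ k}) fun p hp q hq x hx => ?_
    refine le_trans ?_ (sup_le (Set.mem_ofPred.1 hp) (Set.mem_ofPred.1 hq))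
    rw [← prodMap_sup]
    exact (g₁.prodMap g₂).monotone hx.2

/-- Images and preimages are adjoint: the image of `I` lies in `K` iff `I` lies in the preimage of
`K`. So the diagram over the finite grid, placed on preimages and extended by zero, has the required
sums. -/
theorem hasFiniteGPD_comap_prodMap [Finite A] [Finite B] (N : PersistenceModule 𝔽 (A × B))
    (h₁ : Function.Surjective g₁) (h₂ : Function.Surjective g₂) :
    HasFiniteGPD (N.comap (g₁.prodMap g₂)) := by
  have : Finite (PosetInterval (A × B)) :=
    Finite.of_injective _ PosetInterval.carrier_injective
  obtain ⟨g, hg⟩ := exists_isGPD_of_finite N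
  let pre : PosetInterval (A × B) → PosetInterval (α × β) := fun K => K.preimage h₁ h₂
  have hpre : Function.Injective pre := fun K K' h => PosetInterval.carrier_injective
    ((prodMap_surjective h₁ h₂).preimage_injective (congrArg PosetInterval.carrier h))
  let f : PosetInterval (α × β) → ℤ := Function.extend pre g 0
  have hfs : Function.support f ⊆ Set.range pre := by
    intro J hJ
    by_contra h
    exact hJ (Function.extend_apply' g (0 : PosetInterval (α × β) → ℤ) J h)
  have hfin : (Function.support f).Finite := (Set.finite_range pre).subset hfs
  refine IsGPD.hasFiniteGPD (f := f) (fun I => ⟨hfin.subset fun J hJ => hJ.2, ?_⟩) hfin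
  rw [generalizedRank_comap_prodMap N h₁ h₂, (hg _).2]
  change ∑ᶠ (K) (_ : K ∈ {K : PosetInterval (A × B) | (I.image h₁ h₂).carrier ⊆ K.carrier}), g K =
    ∑ᶠ (J) (_ : J ∈ {J : PosetInterval (α × β) | I.carrier ⊆ J.carrier}), f J
  have h1 : ∑ᶠ (J) (_ : J ∈ {J : PosetInterval (α × β) | I.carrier ⊆ J.carrier}), f J =
      ∑ᶠ (J) (_ : J ∈ pre '' {K | (I.image h₁ h₂).carrier ⊆ K.carrier}), f J := by
    refine finsum_mem_inter_support_eq _ _ _ (Set.ext fun J => and_congr_left fun hJ => ?_)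
    obtain ⟨K, rfl⟩ := hfs hJ
    rw [hpre.mem_set_image]
    exact Set.image_subset_iff.symm
  rw [h1, finsum_mem_image hpre.injOn]
  exact finsum_mem_congr rfl fun K _ => (hpre.extend_apply g 0 K).symm

end Grid
end Diagram

/-! ### Finiteness of the diagrams of the sublevel-Rips and sublevel-Čech bifiltrations -/

section Finiteness

variable (𝔽 : Type u) [Field 𝔽]

/-- A filtration over a product of two chains that depends on the point `(a, b)` only through
`(φ a, ψ b)`, where `φ` and `ψ` are monotone with finite range in partial orders, has homology
modules with finite diagrams. -/
theorem hasFiniteGPD_persistentHomology {α β A B V : Type} [LinearOrder α] [LinearOrder β]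
    [PartialOrder A] [PartialOrder B] (φ : α →o A) (ψ : β →o B) (hφ : (Set.range φ).Finite)
    (hψ : (Set.range ψ).Finite) (F : α × β →o PreAbstractSimplicialComplex V)
    (hF : ∀ p q : α × β, φ p.1 = φ q.1 → ψ p.2 = ψ q.2 → F p = F q) (m : ℕ) :
    HasFiniteGPD (persistentHomology 𝔽 F m) := by
  classical
  -- The range of a monotone map out of a chain is a chain, and any section of the corestriction is
  -- automatically monotone: reversing `a ≤ b` would force `b ≤ a`, hence `a = b`.
  have chain : ∀ {γ C : Type} [LinearOrder γ] [PartialOrder C] (χ : γ →o C),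
      (Set.range χ).Finite → ∃ (D : Type) (_ : LinearOrder D) (_ : Finite D) (g : γ →o D)
        (s : D →o γ), Function.Surjective g ∧ ∀ x, χ (s (g x)) = χ x := by
    intro γ C _ _ χ hχ
    let χ' : γ → Set.range χ := Set.rangeFactorization χ
    have hχ' : Monotone χ' := fun x y h => χ.monotone h
    have hs : Function.Surjective χ' := Set.rangeFactorization_surjective
    let _ : LinearOrder (Set.range χ) :=
      { (inferInstance : PartialOrder (Set.range χ)) with
        le_total := fun a b => by
          obtain ⟨x, rfl⟩ := hs a
          obtain ⟨y, rfl⟩ := hs b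
          exact (le_total x y).imp (fun h => hχ' h) (fun h => hχ' h)
        toDecidableLE := Classical.decRel _ }
    refine ⟨Set.range χ, inferInstance, hχ, ⟨χ', hχ'⟩, ⟨Function.surjInv hs, ?_⟩, hs, ?_⟩
    · intro a b hab
      by_contra h
      have h1 := hχ' (not_le.1 h).le
      rw [Function.surjInv_eq hs, Function.surjInv_eq hs] at h1
      exact h (le_antisymm hab h1 ▸ le_rfl)
    · intro x
      exact congrArg Subtype.val (Function.surjInv_eq hs (χ' x))
  obtain ⟨D, _, _, g, s, hg, hs⟩ := chain φ hφ
  obtain ⟨E, _, _, g', s', hg', hs'⟩ := chain ψ hψ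
  have h1 : F = (F.comp (s.prodMap s')).comp (g.prodMap g') := by
    ext1
    funext p
    exact hF _ _ (hs _).symm (hs' _).symm
  have h2 := hasFiniteGPD_comap_prodMap (persistentHomology 𝔽 (F.comp (s.prodMap s')) m) hg hg'
  rw [h1]
  exact h2

theorem finite_range_sublevel {X : Type} [Finite X] (γ : X → ℝ) :
    ∃ φ : ℝ →o Set X, (∀ a, φ a = γ ⁻¹' Set.Iic a) ∧ (Set.range φ).Finite :=
  ⟨⟨fun a => γ ⁻¹' Set.Iic a, fun _ _ h _ hx => le_trans hx h⟩, fun _ => rfl, Set.toFinite _⟩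

theorem hasFiniteGPD_sublevelRips {X : Type} [MetricSpace X] [Finite X] (γ : X → ℝ) (m : ℕ) :
    HasFiniteGPD (persistentHomology 𝔽 (sublevelRips γ) m) := by
  obtain ⟨φ, hφ, hfin⟩ := finite_range_sublevel γ
  let ψ : ℝ≥0 →o Set (X × X) := ⟨fun r => {p | dist p.1 p.2 ≤ r},
    fun r s h p hp => le_trans (Set.mem_ofPred.1 hp) (NNReal.coe_le_coe.2 h)⟩
  refine hasFiniteGPD_persistentHomology 𝔽 φ ψ hfin (Set.toFinite _) _ ?_ m
  intro p q h1 h2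
  rw [hφ, hφ] at h1
  have h3 : ∀ x y, dist x y ≤ p.2 ↔ dist x y ≤ q.2 := fun x y =>
    Set.ext_iff.1 h2 (x, y)
  change ripsComplex (γ ⁻¹' Set.Iic p.1) p.2 = ripsComplex (γ ⁻¹' Set.Iic q.1) q.2
  rw [h1]
  ext s
  simp only [ripsComplex, h3]

/-- The scale enters only through the family of finite subsets of `X` whose balls meet. Finiteness
of `X` bounds these families, and nothing about the ambient space matters. -/
theorem hasFiniteGPD_sublevelCech {E : Type} [MetricSpace E] {X : Set E} (hX : X.Finite)
    (γ : X → ℝ) (m : ℕ) : HasFiniteGPD (persistentHomology 𝔽 (sublevelCech γ) m) := by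
  have : Finite X := hX
  obtain ⟨φ, hφ, hfin⟩ := finite_range_sublevel γ
  let ψ : ℝ≥0 →o Set (Finset X) :=
    ⟨fun r => {s | (⋂ x ∈ s, Metric.closedBall (x : E) (r : ℝ)).Nonempty},
    fun r t h s hs => Set.Nonempty.mono (Set.iInter₂_mono fun x _ =>
      Metric.closedBall_subset_closedBall (NNReal.coe_le_coe.2 h)) hs⟩
  refine hasFiniteGPD_persistentHomology 𝔽 φ ψ hfin (Set.toFinite _) _ ?_ m
  intro p q h1 h2
  rw [hφ, hφ] at h1
  have h3 : ∀ s : Finset X, (⋂ x ∈ s, Metric.closedBall (x : E) (p.2 : ℝ)).Nonempty ↔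
      (⋂ x ∈ s, Metric.closedBall (x : E) (q.2 : ℝ)).Nonempty := fun s => Set.ext_iff.1 h2 s
  change cechComplex (γ ⁻¹' Set.Iic p.1) p.2 = cechComplex (γ ⁻¹' Set.Iic q.1) q.2
  rw [h1]
  ext s
  simp only [cechComplex, h3]

end Finiteness

/-! ### Elementary chains -/

section Chains

variable (𝔽 : Type u) [Field 𝔽] {V : Type}

/-- The oriented simplex `[v₀, …, v_m]` as an alternating chain. -/
noncomputable def orientedSimplex {m : ℕ} (v : Fin (m + 1) → V) : (Fin (m + 1) → V) →₀ 𝔽 :=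
  ∑ σ : Equiv.Perm (Fin (m + 1)), Finsupp.single (v ∘ σ) ((Equiv.Perm.sign σ : ℤ) : 𝔽)

theorem orientedSimplex_mem_chains {K : PreAbstractSimplicialComplex V} {m : ℕ}
    {v : Fin (m + 1) → V} (hv : Function.Injective v) {s : Finset V} (hs : s ∈ K.faces)
    (hsv : (s : Set V) = Set.range v) :
    orientedSimplex 𝔽 v ∈ simplicialChains 𝔽 K m := by
  classical
  refine ⟨fun w hw => ?_, fun τ w => ?_⟩
  · obtain ⟨σ, hσ⟩ : ∃ σ : Equiv.Perm (Fin (m + 1)), Finsupp.single (v ∘ σ)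
        ((Equiv.Perm.sign σ : ℤ) : 𝔽) w ≠ 0 := by
      by_contra! h
      refine hw ?_
      rw [orientedSimplex, Finsupp.finsetSum_apply]
      exact Finset.sum_eq_zero fun σ _ => h σ
    have h1 : v ∘ σ = w := by
      by_contra h
      exact hσ (Finsupp.single_eq_of_ne' h)
    subst h1
    refine ⟨hv.comp σ.injective, s, hs, ?_⟩
    rw [hsv, Set.range_comp, σ.surjective.range_eq, Set.image_univ]
  · rw [orientedSimplex, Finsupp.finsetSum_apply, Finsupp.finsetSum_apply, Finset.mul_sum,
      ← Equiv.sum_comp (Equiv.mulRight τ)]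
    refine Finset.sum_congr rfl fun σ _ => ?_
    have h1 : v ∘ (σ * τ : Equiv.Perm _) = w ∘ τ ↔ v ∘ σ = w := by
      rw [Equiv.Perm.coe_mul, ← Function.comp_assoc]
      exact τ.surjective.injective_comp_right.eq_iff
    simp only [Finsupp.single_apply, Equiv.coe_mulRight, h1, Equiv.Perm.sign_mul]
    split_ifs
    · push_cast
      ring
    · simp

theorem orientedSimplex_two (a b : V) :
    orientedSimplex 𝔽 ![a, b] = Finsupp.single ![a, b] 1 - Finsupp.single ![b, a] 1 := by
  have h1 : (Finset.univ : Finset (Equiv.Perm (Fin 2))) = {1, Equiv.swap 0 1} := by decide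
  have h2 : ![a, b] ∘ Equiv.swap (0 : Fin 2) 1 = ![b, a] := by
    funext i
    fin_cases i <;> simp
  rw [orientedSimplex, h1, Finset.sum_pair (by decide), h2]
  simp [Finsupp.single_neg, sub_eq_add_neg]

theorem orientedSimplex_three (a b c : V) :
    orientedSimplex 𝔽 ![a, b, c] =
      Finsupp.single ![a, b, c] 1 - Finsupp.single ![a, c, b] 1
      + Finsupp.single ![b, c, a] 1 - Finsupp.single ![b, a, c] 1
      + Finsupp.single ![c, a, b] 1 - Finsupp.single ![c, b, a] 1 := by
  have h1 : (Finset.univ : Finset (Equiv.Perm (Fin 3))) =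
    {1, Equiv.swap 1 2, finRotate 3, Equiv.swap 0 1, (finRotate 3)⁻¹, Equiv.swap 0 2} := by decide
  have e1 : ![a, b, c] ∘ Equiv.swap (1 : Fin 3) 2 = ![a, c, b] := by
    funext i
    fin_cases i <;> rfl
  have e2 : ![a, b, c] ∘ Equiv.swap (0 : Fin 3) 1 = ![b, a, c] := by
    funext i
    fin_cases i <;> rfl
  have e3 : ![a, b, c] ∘ Equiv.swap (0 : Fin 3) 2 = ![c, b, a] := by
    funext i
    fin_cases i <;> rfl
  have e4 : ![a, b, c] ∘ finRotate 3 = ![b, c, a] := by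
    funext i
    fin_cases i <;> rfl
  have e5 : ![a, b, c] ∘ ((finRotate 3)⁻¹ : Equiv.Perm (Fin 3)) = ![c, a, b] := by
    funext i
    fin_cases i <;> rfl
  have s1 : Equiv.Perm.sign (Equiv.swap (1 : Fin 3) 2) = -1 := by decide
  have s2 : Equiv.Perm.sign (Equiv.swap (0 : Fin 3) 1) = -1 := by decide
  have s3 : Equiv.Perm.sign (Equiv.swap (0 : Fin 3) 2) = -1 := by decide
  have s4 : Equiv.Perm.sign (finRotate 3) = 1 := by decide
  have s5 : Equiv.Perm.sign ((finRotate 3)⁻¹ : Equiv.Perm (Fin 3)) = 1 := by decide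
  rw [orientedSimplex, h1, Finset.sum_insert (by decide), Finset.sum_insert (by decide),
    Finset.sum_insert (by decide), Finset.sum_insert (by decide), Finset.sum_insert (by decide),
    Finset.sum_singleton, e1, e2, e3, e4, e5, s1, s2, s3, s4, s5]
  simp only [Equiv.Perm.coe_one, Function.comp_id, map_one, Units.val_one, Units.val_neg,
    Int.cast_one, Int.cast_neg, Finsupp.single_neg]
  abel

theorem orientedSimplex_swap (a b : V) :
    orientedSimplex 𝔽 ![a, b] = -orientedSimplex 𝔽 ![b, a] := by
  rw [orientedSimplex_two, orientedSimplex_two]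
  abel

theorem simplicialBoundary_single {m : ℕ} (v : Fin (m + 1) → V) (x : 𝔽) :
    simplicialBoundary 𝔽 V m (Finsupp.single v x) = Finsupp.single (Fin.tail v) x :=
  Finsupp.mapDomain_single

theorem simplicialBoundary_two (a b : V) :
    simplicialBoundary 𝔽 V 1 (orientedSimplex 𝔽 ![a, b]) =
      Finsupp.single ![b] 1 - Finsupp.single ![a] 1 := by
  rw [orientedSimplex_two, map_sub, simplicialBoundary_single, simplicialBoundary_single]
  rfl

theorem simplicialBoundary_three (a b c : V) :
    simplicialBoundary 𝔽 V 2 (orientedSimplex 𝔽 ![a, b, c]) =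
      orientedSimplex 𝔽 ![a, b] + orientedSimplex 𝔽 ![b, c] + orientedSimplex 𝔽 ![c, a] := by
  have t : ∀ x y z : V, Fin.tail ![x, y, z] = ![y, z] := fun x y z => rfl
  simp only [orientedSimplex_three, orientedSimplex_two, map_sub, map_add,
    simplicialBoundary_single, t]
  abel

variable {𝔽}

/-- A linear map that vanishes on the oriented edges that occur in the `1`-chain `c` vanishes
on `c`. -/
theorem map_eq_zero_of_orientedSimplex {N : Type*} [AddCommGroup N] [Module 𝔽 N]
    (φ : ((Fin 2 → V) →₀ 𝔽) →ₗ[𝔽] N) {K : PreAbstractSimplicialComplex V}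
    {c : (Fin 2 → V) →₀ 𝔽} (hc : c ∈ simplicialChains 𝔽 K 1)
    (h : ∀ a b : V, a ≠ b → c ![a, b] ≠ 0 → φ (orientedSimplex 𝔽 ![a, b]) = 0) : φ c = 0 := by
  classical
  induction hk : c.support.card using Nat.strong_induction_on generalizing c with
  | _ k ih =>
    by_cases h0 : c = 0
    · rw [h0, map_zero]
    obtain ⟨v, hv⟩ := Finsupp.ne_iff.1 h0
    rw [Finsupp.zero_apply] at hv
    obtain ⟨a, b, rfl⟩ : ∃ a b, v = ![a, b] := ⟨v 0, v 1, by
      funext i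
      fin_cases i <;> rfl⟩
    obtain ⟨hi, s, hs, hsv⟩ := hc.1 _ hv
    have hab : a ≠ b := fun e => absurd (hi (a₁ := 0) (a₂ := 1) (by simpa using e)) (by simp)
    have hba : c ![b, a] = -c ![a, b] := by
      have h1 := hc.2 (Equiv.swap 0 1) ![a, b]
      have h2 : ![a, b] ∘ Equiv.swap (0 : Fin 2) 1 = ![b, a] := by
        funext i
        fin_cases i <;> simp
      rw [h2, Equiv.Perm.sign_swap (by simp)] at h1
      simpa using h1
    have hne : ![a, b] ≠ ![b, a] := fun e => hab (congrFun e 0)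
    -- By alternation this removes both orderings of the edge at once, so the support shrinks.
    -- Peeling off edges in this way never divides by `2` and works in every characteristic.
    let d := c - c ![a, b] • orientedSimplex 𝔽 ![a, b]
    have hd : d ∈ simplicialChains 𝔽 K 1 :=
      sub_mem hc (Submodule.smul_mem _ _ (orientedSimplex_mem_chains 𝔽 hi hs hsv))
    have hdab : d ![a, b] = 0 := by
      simp [d, orientedSimplex_two, hne.symm]
    have hdsupp : ∀ w, d w ≠ 0 → c w ≠ 0 := by
      intro w hw hcw
      have h1 : ![a, b] ≠ w := fun e => hv (e ▸ hcw)
      have h2 : ![b, a] ≠ w := fun e => hv (by rw [← neg_eq_zero, ← hba, e, hcw])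
      refine hw ?_
      simp [d, orientedSimplex_two, h1, h2, hcw]
    have hlt : d.support.card < c.support.card := by
      refine Finset.card_lt_card ⟨fun w hw => ?_, fun hsub => ?_⟩
      · rw [Finsupp.mem_support_iff] at hw ⊢
        exact hdsupp w hw
      · exact Finsupp.mem_support_iff.1 (hsub (Finsupp.mem_support_iff.2 hv)) hdab
    have h1 := ih _ (hk ▸ hlt) hd (fun x y hxy hw => h x y hxy (hdsupp _ hw)) rfl
    rw [map_sub, map_smul, h a b hab hv, smul_zero, sub_zero] at h1
    exact h1

end Chains

/-! ### The model module -/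

section Model

variable {𝔽 : Type u} [Field 𝔽] {n : ℕ}

theorem fin_one_eta {V : Type} (v : Fin 1 → V) : v = ![v 0] := by
  funext i
  fin_cases i
  rfl

/-- The linear extension of the map that sends every `0`-simplex to `1`. -/
noncomputable def augmentation (𝔽 : Type u) [Field 𝔽] (V : Type) :
    ((Fin 1 → V) →₀ 𝔽) →ₗ[𝔽] 𝔽 :=
  Finsupp.linearCombination 𝔽 fun _ => 1

theorem augmentation_single {V : Type} (v : Fin 1 → V) (x : 𝔽) :
    augmentation 𝔽 V (Finsupp.single v x) = x := by
  simp [augmentation]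

theorem augmentation_boundary {V : Type} {K : PreAbstractSimplicialComplex V}
    {c : (Fin 1 → V) →₀ 𝔽} (hc : c ∈ simplicialBoundaries 𝔽 K 0) : augmentation 𝔽 V c = 0 := by
  obtain ⟨d, hd, rfl⟩ := hc
  refine map_eq_zero_of_orientedSimplex (augmentation 𝔽 V ∘ₗ simplicialBoundary 𝔽 V 1) hd ?_
  intro a b _ _
  rw [LinearMap.comp_apply, simplicialBoundary_two, map_sub, augmentation_single,
    augmentation_single, sub_self]

theorem simplicialCycles_zero {V : Type} (K : PreAbstractSimplicialComplex V) :
    simplicialCycles 𝔽 K 0 = simplicialChains 𝔽 K 0 := if_pos rfl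

theorem mem_chains_zero {V : Type} {K : PreAbstractSimplicialComplex V} {c : (Fin 1 → V) →₀ 𝔽} :
    c ∈ simplicialChains 𝔽 K 0 ↔ ∀ v, c ![v] ≠ 0 → {v} ∈ K.faces := by
  constructor
  · rintro ⟨h, -⟩ v hv
    obtain ⟨-, s, hs, hsv⟩ := h _ hv
    have : s = {v} := by
      rw [← Finset.coe_inj, hsv]
      simp
    rwa [← this]
  · refine fun h => ⟨fun v hv => ⟨Function.injective_of_subsingleton (α := Fin 1) v, {v 0}, ?_, ?_⟩, ?_⟩
    · rw [fin_one_eta v] at hv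
      exact h _ hv
    · rw [fin_one_eta v]
      simp
    · intro σ v
      have : σ = 1 := Subsingleton.elim (α := Equiv.Perm (Fin 1)) _ _
      simp [this]

/-- For `n > 0` the top is off the antidiagonal, so the complete-graph clause contributes no further
vertices. -/
theorem singleton_mem_modelFiltration (hn : 0 < n) {p : Fin (n + 1) × Fin (n + 1)}
    {v : Fin (n + 1)} : {v} ∈ (modelFiltration n p).faces ↔
      n ≤ (p.1 : ℕ) + p.2 ∧ ((p.1 : ℕ) + p.2 = n → p.1 ≠ v) := by
  change (_ ∧ _ ∧ _) ↔ _
  simp only [Finset.singleton_nonempty, Finset.card_singleton, Finset.mem_singleton, true_and]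
  refine and_congr_right fun _ => ?_
  constructor
  · rintro (h | ⟨h1, h2, -⟩)
    · exact h
    · exact fun h => by omega
  · exact Or.inl

theorem modelFiltration_boundaries_eq_bot {p : Fin (n + 1) × Fin (n + 1)}
    (hp : (p.1 : ℕ) + p.2 < 2 * n) : simplicialBoundaries 𝔽 (modelFiltration n p) 0 = ⊥ := by
  rw [eq_bot_iff]
  rintro _ ⟨c, hc, rfl⟩
  have : c = 0 := by
    ext v
    by_contra h
    obtain ⟨hi, s, ⟨-, -, hs⟩, hsv⟩ := hc.1 v h
    have h2 : s.card = 2 := by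
      rw [← Set.ncard_coe_finset, hsv, ← Set.image_univ, Set.ncard_image_of_injective _ hi]
      simp
    rcases hs with ⟨h, -⟩ | ⟨h, h', -⟩ <;> omega
  rw [this, map_zero]
  exact Submodule.zero_mem _

theorem modelFiltration_mem_boundaries {c : (Fin 1 → Fin (n + 1)) →₀ 𝔽}
    (hc : augmentation 𝔽 _ c = 0) :
    c ∈ simplicialBoundaries 𝔽 (modelFiltration n (Fin.last n, Fin.last n)) 0 := by
  classical
  set B := simplicialBoundaries 𝔽 (modelFiltration n (Fin.last n, Fin.last n)) 0
  have h1 : ∀ v : Fin (n + 1), Finsupp.single ![v] 1 - Finsupp.single ![0] 1 ∈ B := by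
    intro v
    by_cases hv : v = 0
    · rw [hv, sub_self]
      exact zero_mem _
    refine ⟨orientedSimplex 𝔽 ![0, v], orientedSimplex_mem_chains 𝔽 ?_ (s := {0, v}) ?_ ?_,
      simplicialBoundary_two 𝔽 0 v⟩
    · intro i j h
      fin_cases i <;> fin_cases j <;> simp_all [eq_comm]
    · refine ⟨by simp, by simp, Or.inr ⟨by simp, by simp, Finset.card_le_two⟩⟩
    · simp [Set.pair_comm]
  -- The subtracted multiples of `z_0` sum to the augmentation of `c`, which is zero; each remaining
  -- difference bounds an edge of the complete graph.
  have h2 : c = ∑ v ∈ c.support, c v • (Finsupp.single v 1 - Finsupp.single ![0] 1) := by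
    simp only [smul_sub, Finset.sum_sub_distrib, Finsupp.smul_single, smul_eq_mul, mul_one]
    have h3 : ∑ v ∈ c.support, Finsupp.single (![0] : Fin 1 → Fin (n + 1)) (c v) = 0 := by
      rw [← Finsupp.single_finsetSum]
      have h4 : ∑ v ∈ c.support, c v = 0 := by
        rw [← hc, augmentation, Finsupp.linearCombination_apply, Finsupp.sum]
        simp
      rw [h4, Finsupp.single_zero]
    rw [h3, sub_zero]
    exact (Finsupp.sum_single c).symm
  rw [h2]
  refine sum_mem fun v _ => Submodule.smul_mem _ _ ?_
  rw [fin_one_eta v]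
  exact h1 _

end Model

/-! ### The intervals `{i + j > n} ∪ {(i, n - i) | i ∈ S}` and their images in a larger poset -/

section Intervals

variable {n : ℕ}

/-- The interval of the grid that consists of the points above the antidiagonal and of the points
`(i, n - i)` of the antidiagonal with `i ∈ S`. -/
def gridInterval (hn : 0 < n) (S : Finset (Fin (n + 1))) :
    PosetInterval (Fin (n + 1) × Fin (n + 1)) where
  carrier := {p | n < (p.1 : ℕ) + p.2 ∨ ((p.1 : ℕ) + p.2 = n ∧ p.1 ∈ S)}
  nonempty := ⟨(Fin.last n, Fin.last n), Or.inl (by simp [hn])⟩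
  convex := by
    refine IsUpperSet.ordConnected ?_
    rintro ⟨a, b⟩ ⟨c, d⟩ ⟨hac, hbd⟩ h
    have hac' : (a : ℕ) ≤ c := hac
    have hbd' : (b : ℕ) ≤ d := hbd
    simp only [Set.mem_ofPred_eq] at h ⊢
    by_cases h1 : (a : ℕ) + b = (c : ℕ) + d
    · have : a = c := Fin.ext (by omega)
      subst this
      rcases h with h | h
      · exact Or.inl (by omega)
      · exact Or.inr ⟨by omega, h.2⟩
    · exact Or.inl (by omega)
  connected := by
    intro p q
    let t : {p : Fin (n + 1) × Fin (n + 1) |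
        n < (p.1 : ℕ) + p.2 ∨ ((p.1 : ℕ) + p.2 = n ∧ p.1 ∈ S)} :=
      ⟨(Fin.last n, Fin.last n), Or.inl (by simp [hn])⟩
    have ht : ∀ p, p ≤ t := fun p => ⟨Fin.le_last _, Fin.le_last _⟩
    exact Relation.ReflTransGen.tail (b := t) (Relation.ReflTransGen.single (Or.inl (ht p)))
      (Or.inr (ht q))

theorem gridInterval_upper (hn : 0 < n) (S : Finset (Fin (n + 1)))
    {p q : Fin (n + 1) × Fin (n + 1)} (hpq : p ≤ q) (hp : p ∈ (gridInterval hn S).carrier) :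
    q ∈ (gridInterval hn S).carrier :=
  (gridInterval hn S).convex.out hp (Or.inl (by simp [hn]) :
    (Fin.last n, Fin.last n) ∈ (gridInterval hn S).carrier)
    ⟨hpq, Fin.le_last _, Fin.le_last _⟩

theorem top_mem_gridInterval (hn : 0 < n) (S : Finset (Fin (n + 1))) :
    (Fin.last n, Fin.last n) ∈ (gridInterval hn S).carrier := Or.inl (by simp [hn])

theorem le_top_grid (p : Fin (n + 1) × Fin (n + 1)) : p ≤ (Fin.last n, Fin.last n) :=
  ⟨Fin.le_last _, Fin.le_last _⟩

/-- The convex hull of the image of `gridInterval hn S` under a monotone map. -/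
def hullInterval {P : Type} [PartialOrder P] (ι : Fin (n + 1) × Fin (n + 1) →o P) (hn : 0 < n)
    (S : Finset (Fin (n + 1))) : PosetInterval P where
  carrier := {x | (∃ k ∈ (gridInterval hn S).carrier, ι k ≤ x) ∧ x ≤ ι (Fin.last n, Fin.last n)}
  nonempty := ⟨ι (Fin.last n, Fin.last n), ⟨_, top_mem_gridInterval hn S, le_rfl⟩, le_rfl⟩
  convex := ⟨fun _ ⟨⟨k, hk, hx⟩, _⟩ _ ⟨_, hy⟩ _ ⟨h1, h2⟩ => ⟨⟨k, hk, hx.trans h1⟩, h2.trans hy⟩⟩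
  connected := by
    intro p q
    let t : {x | (∃ k ∈ (gridInterval hn S).carrier, ι k ≤ x) ∧ x ≤ ι (Fin.last n, Fin.last n)} :=
      ⟨ι (Fin.last n, Fin.last n), ⟨_, top_mem_gridInterval hn S, le_rfl⟩, le_rfl⟩
    have ht : ∀ p, p ≤ t := fun p => p.2.2
    exact Relation.ReflTransGen.tail (b := t) (Relation.ReflTransGen.single (Or.inl (ht p)))
      (Or.inr (ht q))

/-- A point of the hull not already over `S = ∅` lies between some `ι (i, n - i)` with `i ∈ S` and
the image of the top, so convexity of `J` captures it. Containment is thus governed by the trace of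
`J` on the antidiagonal. -/
theorem hullInterval_subset_iff {P : Type} [PartialOrder P] (ι : Fin (n + 1) × Fin (n + 1) →o P)
    (hn : 0 < n) (S : Finset (Fin (n + 1))) (J : PosetInterval P) :
    (hullInterval ι hn S).carrier ⊆ J.carrier ↔
      (hullInterval ι hn ∅).carrier ⊆ J.carrier ∧ ∀ i ∈ S, ι (i, Fin.rev i) ∈ J.carrier := by
  have hle : ∀ i : Fin (n + 1), ((i : ℕ) + (Fin.rev i : ℕ)) = n := fun i => by
    rw [Fin.val_rev]
    omega
  constructor
  · refine fun h => ⟨Set.Subset.trans ?_ h, fun i hi => h ⟨⟨(i, Fin.rev i), ?_, le_rfl⟩, ?_⟩⟩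
    · rintro x ⟨⟨k, hk, hx⟩, hx'⟩
      exact ⟨⟨k, Or.inl (by simpa [gridInterval] using hk), hx⟩, hx'⟩
    · exact Or.inr ⟨hle i, hi⟩
    · exact ι.monotone (le_top_grid _)
  · rintro ⟨h1, h2⟩ x ⟨⟨⟨a, b⟩, hk | ⟨hk, hkS⟩, hx⟩, hx'⟩
    · exact h1 ⟨⟨(a, b), Or.inl hk, hx⟩, hx'⟩
    · have hb : b = Fin.rev a := Fin.ext (by have := hle a; simp only at hk; omega)
      subst hb
      exact J.convex.out (h2 a hkS) (h1 ⟨⟨_, top_mem_gridInterval hn ∅, le_rfl⟩, le_rfl⟩) ⟨hx, hx'⟩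

/-- The map into the hull is final because every hull point lies below the image of the top, and
initial because the grid points mapped below a given `x` are closed under joins by `hι`. -/
theorem generalizedRank_hullInterval {𝔽 : Type u} [Field 𝔽] {P : Type} [PartialOrder P]
    (ι : Fin (n + 1) × Fin (n + 1) →o P) (hι : ∀ a b x, ι a ≤ x → ι b ≤ x → ι (a ⊔ b) ≤ x)
    (hn : 0 < n) (S : Finset (Fin (n + 1))) (M : PersistenceModule 𝔽 P) :
    generalizedRank M (hullInterval ι hn S) = generalizedRank (M.comap ι) (gridInterval hn S) := by
  refine (generalizedRank_comap M ι _ _ ?_ ?_ ?_ ?_ ?_).symm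
  · exact fun p hp => ⟨⟨p, hp, le_rfl⟩, ι.monotone (le_top_grid _)⟩
  · exact fun k hk => ⟨_, top_mem_gridInterval hn S, hk.2⟩
  · intro k hk p q
    let t : {p | p ∈ (gridInterval hn S).carrier ∧ k ≤ ι p} := ⟨_, top_mem_gridInterval hn S, hk.2⟩
    have ht : ∀ p, p ≤ t := fun p => ⟨Fin.le_last _, Fin.le_last _⟩
    exact Relation.ReflTransGen.tail (b := t) (Relation.ReflTransGen.single (Or.inl (ht p)))
      (Or.inr (ht q))
  · exact fun k ⟨⟨p, hp, hk⟩, _⟩ => ⟨p, hp, hk⟩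
  · intro k hk p q
    let t : {p | p ∈ (gridInterval hn S).carrier ∧ ι p ≤ k} := ⟨p.1 ⊔ q.1,
      gridInterval_upper hn S le_sup_left p.2.1, hι _ _ _ p.2.2 q.2.2⟩
    have h1 : p ≤ t := le_sup_left (a := p.1)
    have h2 : q ≤ t := le_sup_right (a := p.1)
    exact Relation.ReflTransGen.tail (b := t) (Relation.ReflTransGen.single (Or.inl h1))
      (Or.inr h2)

end Intervals

/-! ### The lower bound on the size of the diagram -/

section Counting

variable {𝔽 : Type u} [Field 𝔽]

/-- Inversion of a sum over supersets. -/
theorem sum_superset_unique {E : Type} [Fintype E] [DecidableEq E] {g h : Finset E → ℤ}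
    (H : ∀ S, ∑ T with S ⊆ T, g T = ∑ T with S ⊆ T, h T) (S : Finset E) : g S = h S := by
  induction S using WellFoundedGT.induction with
  | _ S ih =>
    have h1 : (Finset.univ.filter fun T : Finset E => S ⊆ T) =
        insert S (Finset.univ.filter fun T : Finset E => S < T) := by
      ext T
      simp [le_iff_lt_or_eq, or_comm, eq_comm]
    have h2 := H S
    rw [h1, Finset.sum_insert (by simp), Finset.sum_insert (by simp)] at h2
    rw [Finset.sum_congr rfl fun T hT => ih T (Finset.mem_filter.1 hT).2] at h2
    exact add_right_cancel h2

/-- Möbius inversion gives `h T = [T = E] - (-1)^{|E ∖ T|}`: the alternating sum over the supersets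
of `S` vanishes unless `S` is everything. -/
theorem ne_zero_of_sum_superset {E : Type} [Fintype E] [DecidableEq E] {h : Finset E → ℤ}
    (H : ∀ S, ∑ T with S ⊆ T, h T = if S = Finset.univ then 0 else 1) {S : Finset E}
    (hS : S ≠ Finset.univ) : h S ≠ 0 := by
  have key := sum_superset_unique
    (g := fun T => (if T = Finset.univ then 1 else 0) - (-1) ^ Tᶜ.card) (h := h) (fun S => ?_) S
  · rw [← key, if_neg hS, zero_sub]
    exact neg_ne_zero.2 (pow_ne_zero _ (by norm_num))
  · rw [H, Finset.sum_sub_distrib]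
    have h1 : ∑ T with S ⊆ T, (if T = Finset.univ then (1 : ℤ) else 0) = 1 := by
      rw [Finset.sum_ite_eq' _ Finset.univ, if_pos (by simp)]
    have h2 : ∑ T with S ⊆ T, (-1 : ℤ) ^ Tᶜ.card = ∑ U ∈ Sᶜ.powerset, (-1 : ℤ) ^ U.card := by
      refine Finset.sum_nbij' (fun T => Tᶜ) (fun T => Tᶜ) ?_ ?_ ?_ ?_ ?_
      · intro T hT
        simpa using hT
      · intro T hT
        simpa [Finset.subset_compl_comm] using hT
      · simp
      · simp
      · simp
    rw [h1, h2, Finset.sum_powerset_neg_one_pow_card]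
    by_cases hS : S = Finset.univ
    · simp [hS]
    · simp [hS]

/-- The values of `f` on single intervals are out of reach, but by `hI` the rank conditions
determine the sum of `f` over all `J ⊇ I ∅` with a prescribed trace on the points `p i`. Each such
sum for a proper subset is nonzero, and different traces come from different intervals. -/
theorem IsGPD.two_pow_sub_one_le_encard_support {P : Type} [PartialOrder P]
    {M : PersistenceModule 𝔽 P} {f : PosetInterval P → ℤ} (hf : IsGPD M f) {E : Type} [Fintype E]
    [DecidableEq E] (I : Finset E → PosetInterval P) (p : E → P)
    (hI : ∀ (S) (J : PosetInterval P), (I S).carrier ⊆ J.carrier ↔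
      (I ∅).carrier ⊆ J.carrier ∧ ∀ i ∈ S, p i ∈ J.carrier)
    (hr : ∀ S, generalizedRank M (I S) = if S = Finset.univ then 0 else 1) :
    (2 ^ Fintype.card E - 1 : ℕ) ≤ (Function.support f).encard := by
  classical
  let s : Finset (PosetInterval P) := (hf (I ∅)).1.toFinset
  have hs : ∀ J, J ∈ s ↔ (I ∅).carrier ⊆ J.carrier ∧ f J ≠ 0 := fun J => by simp [s]
  let tr : PosetInterval P → Finset E := fun J => Finset.univ.filter fun i => p i ∈ J.carrier
  let h : Finset E → ℤ := fun T => ∑ J ∈ s with tr J = T, f J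
  have hH : ∀ S, ∑ T with S ⊆ T, h T = if S = Finset.univ then 0 else 1 := by
    intro S
    have h1 : ∑ T with S ⊆ T, h T = ∑ J ∈ s with S ⊆ tr J, f J := by
      simp only [h]
      rw [Finset.sum_comm' (t' := s.filter fun J => S ⊆ tr J) (s' := fun J => {tr J})]
      · simp
      · intro T J
        simp only [Finset.mem_filter, Finset.mem_univ, true_and, Finset.mem_singleton]
        constructor
        · rintro ⟨h1, h2, rfl⟩
          exact ⟨rfl, h2, h1⟩
        · rintro ⟨rfl, h2, h1⟩
          exact ⟨h1, h2, rfl⟩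
    have h2 : (generalizedRank M (I S) : ℤ) = ∑ J ∈ s with S ⊆ tr J, f J := by
      rw [(hf (I S)).2]
      change ∑ᶠ (J) (_ : J ∈ {J : PosetInterval P | (I S).carrier ⊆ J.carrier}), f J = _
      rw [← finsum_mem_coe_finset]
      refine finsum_mem_inter_support_eq _ _ _ (Set.ext fun J => and_congr_left fun hJ => ?_)
      rw [Set.mem_ofPred_eq, hI S J, Finset.mem_coe, Finset.mem_filter, hs]
      have : S ⊆ tr J ↔ ∀ i ∈ S, p i ∈ J.carrier := by
        simp [tr, Finset.subset_iff]
      rw [this]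
      exact ⟨fun h => ⟨⟨h.1, hJ⟩, h.2⟩, fun h => ⟨h.1.1, h.2⟩⟩
    rw [h1, ← h2, hr]
    split_ifs <;> simp
  have h3 : (Finset.univ.erase Finset.univ : Finset (Finset E)) ⊆ s.image tr := by
    intro S hS
    obtain ⟨J, hJ, -⟩ := Finset.exists_ne_zero_of_sum_ne_zero
      (ne_zero_of_sum_superset hH (Finset.ne_of_mem_erase hS))
    rw [Finset.mem_filter] at hJ
    exact Finset.mem_image.2 ⟨J, hJ⟩
  have h4 : 2 ^ Fintype.card E - 1 ≤ s.card := by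
    refine le_trans ?_ ((Finset.card_le_card h3).trans Finset.card_image_le)
    rw [Finset.card_erase_of_mem (Finset.mem_univ _), Finset.card_univ, Fintype.card_finset]
  calc ((2 ^ Fintype.card E - 1 : ℕ) : ℕ∞) ≤ s.card := by exact_mod_cast h4
    _ = (s : Set (PosetInterval P)).encard := (Set.encard_coe_eq_coe_finsetCard s).symm
    _ ≤ _ := Set.encard_le_encard fun J hJ => ((hs J).1 hJ).2

end Counting

/-! ### Generalized ranks of the model module. -/

section ModelRank

variable {𝔽 : Type u} [Field 𝔽] {n : ℕ}

theorem limitColimitRank_of_isTop {J : Type} [Preorder J] (F : J ⥤ ModuleCat.{u} 𝔽) (t : J)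
    (ht : ∀ j, j ≤ t) :
    limitColimitRank F t = Module.finrank 𝔽 (LinearMap.range (limit.π F t).hom) := by
  have hT : IsTerminal t := IsTerminal.ofUniqueHom (fun j => homOfLE (ht j))
    (fun _ _ => Subsingleton.elim _ _)
  have := isIso_ι_of_isTerminal hT F
  have h := finrank_range_iso_comp_iso (Iso.refl _) (limit.π F t) (asIso (colimit.ι F t))
  rw [Iso.refl_hom, Category.id_comp] at h
  exact h

theorem Subquotient.mk_eq_mk {W : Type u} [AddCommGroup W] [Module 𝔽 W] {Z B : Submodule 𝔽 W}
    (x y : Z) : Subquotient.mk Z B x = Subquotient.mk Z B y ↔ (x : W) - y ∈ B := by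
  rw [← sub_eq_zero, ← map_sub, Subquotient.mk_eq_zero]
  rfl

/-- The augmentation on the module at the top of the grid. -/
noncomputable def topAugmentation (𝔽 : Type u) [Field 𝔽] (n : ℕ) :
    SimplicialHomology 𝔽 (modelFiltration n (Fin.last n, Fin.last n)) 0 →ₗ[𝔽] 𝔽 :=
  Submodule.liftQ _ (augmentation 𝔽 (Fin (n + 1)) ∘ₗ Submodule.subtype _)
    fun _ hc => augmentation_boundary hc

theorem topAugmentation_injective : Function.Injective (topAugmentation 𝔽 n) := by
  rw [injective_iff_map_eq_zero]
  intro x hx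
  obtain ⟨c, rfl⟩ := Subquotient.mk_surjective _ _ x
  rw [Subquotient.mk_eq_zero]
  exact modelFiltration_mem_boundaries hx

theorem finrank_range_limit_π_le_one {J : Type} [Preorder J] (F : J ⥤ ModuleCat.{u} 𝔽) (t : J)
    (φ : F.obj t →ₗ[𝔽] 𝔽) (hφ : Function.Injective φ) :
    Module.finrank 𝔽 (LinearMap.range (limit.π F t).hom) ≤ 1 := by
  rw [← Module.finrank_self 𝔽]
  exact LinearMap.finrank_le_finrank_of_injective
    (f := φ ∘ₗ Submodule.subtype (LinearMap.range (limit.π F t).hom))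
    (hφ.comp Subtype.val_injective)

/-- The colimit is the value at the top, which the augmentation embeds in `𝔽`, so the rank is at
most one. A vertex `z_k` with `k ∉ S` exists over the whole interval and realizes it. If `S` is
everything, each coordinate of a section is killed at one point of the antidiagonal. -/
theorem generalizedRank_modelModule (hn : 2 ≤ n) (S : Finset (Fin (n + 1))) :
    generalizedRank (modelModule 𝔽 n) (gridInterval (by omega) S) =
      if S = Finset.univ then 0 else 1 := by
  have hn0 : 0 < n := by omega
  set L := gridInterval hn0 S with hL
  let t : L.carrier := ⟨_, top_mem_gridInterval hn0 S⟩
  have ht : ∀ p, p ≤ t := fun p => ⟨Fin.le_last _, Fin.le_last _⟩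
  rw [generalizedRank_eq _ L t, limitColimitRank_of_isTop _ t ht]
  set F := (modelModule 𝔽 n).restrict L.carrier
  split_ifs with hS
  · suffices h : (limit.π F t).hom = 0 by
      rw [h, LinearMap.range_zero, finrank_bot]
    ext x
    have hsurj : ∀ q : L.carrier, ∃ c : simplicialCycles 𝔽 (modelFiltration n q) 0,
        Subquotient.mk _ (simplicialBoundaries 𝔽 (modelFiltration n q) 0) c =
          (limit.π F q).hom x := fun q => Subquotient.mk_surjective _ _ _
    choose c hc using hsurj
    have hw : ∀ q q' : L.carrier, ∀ h : q ≤ q', (F.map (homOfLE h)).hom ((limit.π F q).hom x) =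
        (limit.π F q').hom x := fun q q' h => by
      rw [← limit.w F (homOfLE h)]
      rfl
    -- Below the top there are no boundaries, so equal classes have equal representing chains.
    have hcc : ∀ q q' : L.carrier, q ≤ q' → ((q'.1.1 : ℕ) + q'.1.2 < 2 * n) →
        (c q).1 = (c q').1 := by
      intro q q' h h'
      have h1 := hw q q' h
      rw [← hc, ← hc] at h1
      have hle : modelFiltration n q ≤ modelFiltration n q' := (modelFiltration n).monotone h
      have h2 : ((c q).1 - (c q').1) ∈ simplicialBoundaries 𝔽 (modelFiltration n q') 0 :=
        (Subquotient.mk_eq_mk (Submodule.inclusion (simplicialCycles_mono 𝔽 hle 0) (c q))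
        (c q')).1 h1
      rw [modelFiltration_boundaries_eq_bot h'] at h2
      exact sub_eq_zero.1 h2
    let A : Fin (n + 1) → L.carrier := fun i => ⟨(i, Fin.rev i), Or.inr ⟨by
      simp only [Fin.val_rev]
      omega, by simp [hS]⟩⟩
    have hA : ∀ i : Fin (n + 1), (c (A i)).1 = (c (A 0)).1 := by
      intro i
      induction i using Fin.induction with
      | zero => rfl
      | succ i ih =>
        -- The point `(i + 1, n - i)` lies above two neighbouring antidiagonal points. Its
        -- coordinate sum is `n + 1`, which is below `2 * n` because `n ≥ 2`.
        let B : L.carrier := ⟨(i.succ, Fin.rev i.castSucc), Or.inl (by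
          simp only [Fin.val_succ, Fin.val_rev, Fin.val_castSucc]
          omega)⟩
        have hB : (B.1.1 : ℕ) + B.1.2 < 2 * n := by
          simp only [B, Fin.val_succ, Fin.val_rev, Fin.val_castSucc]
          omega
        rw [hcc (A i.succ) B ⟨le_rfl, Fin.rev_le_rev.2 (Fin.castSucc_lt_succ).le⟩ hB,
          ← ih, hcc (A i.castSucc) B ⟨(Fin.castSucc_lt_succ).le, le_rfl⟩ hB]
    -- The coordinate at `z_v` vanishes because `z_v` is absent at the antidiagonal point with first
    -- coordinate `v`.
    have h0 : (c (A 0)).1 = 0 := by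
      ext v
      rw [fin_one_eta v]
      by_contra h
      have h1 : (c (A (v 0))).1 ∈ simplicialChains 𝔽 (modelFiltration n (A (v 0))) 0 := by
        rw [← simplicialCycles_zero]
        exact (c (A (v 0))).2
      rw [mem_chains_zero, hA] at h1
      exact ((singleton_mem_modelFiltration hn0).1 (h1 _ h)).2 (by
        simp only [A, Fin.val_rev]
        omega) rfl
    have h1 : c (A 0) = 0 := Subtype.ext h0
    have h2 := hw (A 0) t (ht _)
    rw [← hc, h1, map_zero] at h2
    exact h2.symm.trans (map_zero (F.map (homOfLE (ht (A 0)))).hom)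
  · refine le_antisymm (finrank_range_limit_π_le_one F t (topAugmentation 𝔽 n)
      topAugmentation_injective) ?_
    obtain ⟨k, hk⟩ : ∃ k, k ∉ S := by
      by_contra! h
      exact hS (Finset.eq_univ_iff_forall.2 h)
    have hz : ∀ q : L.carrier, Finsupp.single ![k] 1 ∈
        simplicialCycles 𝔽 (modelFiltration n q) 0 := by
      intro q
      rw [simplicialCycles_zero, mem_chains_zero]
      intro v hv
      have hv' : k = v := by
        by_contra h
        refine hv (Finsupp.single_eq_of_ne fun e => h (congrFun e 0).symm)
      subst hv'
      rw [singleton_mem_modelFiltration hn0]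
      rcases q.2 with h | ⟨h, h'⟩
      · exact ⟨h.le, fun e => by omega⟩
      · exact ⟨h.ge, fun _ e => hk (e ▸ h')⟩
    let x : ∀ q : L.carrier, F.obj q := fun q => Subquotient.mk _ _ ⟨_, hz q⟩
    let s : Cone F :=
      { pt := ModuleCat.of 𝔽 𝔽
        π :=
          { app := fun q => ModuleCat.ofHom (LinearMap.toSpanSingleton 𝔽 (F.obj q) (x q))
            naturality := fun q q' h => by
              ext
              change (1 : 𝔽) • x q' = (F.map h).hom ((1 : 𝔽) • x q)
              rw [one_smul, one_smul]
              rfl } }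
    have hx : x t ∈ LinearMap.range (limit.π F t).hom := by
      refine ⟨(limit.lift F s).hom (1 : 𝔽), ?_⟩
      have h1 : (limit.lift F s ≫ limit.π F t).hom (1 : 𝔽) = (s.π.app t).hom (1 : 𝔽) := by
        rw [limit.lift_π]
      refine Eq.trans h1 ?_
      exact one_smul 𝔽 (x t)
    have hxt : topAugmentation 𝔽 n (x t) = 1 := augmentation_single _ _
    have : Module.Finite 𝔽 (F.obj t) :=
      Module.Finite.of_injective (topAugmentation 𝔽 n) topAugmentation_injective
    refine Submodule.one_le_finrank_iff.2 fun h => ?_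
    rw [h, Submodule.mem_bot] at hx
    rw [hx] at hxt
    exact zero_ne_one (Eq.trans (map_zero (topAugmentation 𝔽 n)).symm hxt)

/-- A module whose pullback along a join-preserving map is the model module has a diagram of
exponential size. -/
theorem two_pow_le_gpdSize {P : Type} [PartialOrder P] (hn : 2 ≤ n) {M : PersistenceModule 𝔽 P}
    (hM : HasFiniteGPD M) (ι : Fin (n + 1) × Fin (n + 1) →o P)
    (hι : ∀ a b x, ι a ≤ x → ι b ≤ x → ι (a ⊔ b) ≤ x)
    (e : M.comap ι ≅ modelModule 𝔽 n) : (2 ^ (n + 1) - 1 : ℕ) ≤ gpdSize M := by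
  have h := hM.isGPD.two_pow_sub_one_le_encard_support (hullInterval ι (by omega))
    (fun i => ι (i, Fin.rev i)) (hullInterval_subset_iff ι _) (fun S => by
      rw [generalizedRank_hullInterval ι hι, generalizedRank_congr e,
        generalizedRank_modelModule hn])
  rwa [Fintype.card_fin] at h

end ModelRank

/-! ### Combinatorial description of the witnesses -/

section Witness

/-- Labels of the points of the witness of parameter `n`: `inl (i, j)` stands for the square
`b_j A` in `Y_i`, `inr i` for the square `Z_i`, and the last component is the direction. -/
abbrev WitnessLabel (n : ℕ) : Type :=
  ({q : Fin (n + 1) × Fin (n + 1) // q.2 ≠ q.1} ⊕ Fin n) × Fin 4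

namespace WitnessLabel

variable {n : ℕ}

/-- The height of the point, divided by `n`. -/
def level (v : WitnessLabel n) : ℕ :=
  Sum.elim (fun q : {q : Fin (n + 1) × Fin (n + 1) // q.2 ≠ q.1} => 2 * (q.1.1 : ℕ))
    (fun i : Fin n => 2 * (i : ℕ) + 1) v.1

/-- The index `j` of the square `b_j A` of the point. -/
def index (v : WitnessLabel n) : ℕ :=
  Sum.elim (fun q : {q : Fin (n + 1) × Fin (n + 1) // q.2 ≠ q.1} => (q.1.2 : ℕ))
    (fun _ : Fin n => 0) v.1

/-- The value of `γ_n`. -/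
def value (v : WitnessLabel n) : ℕ :=
  Sum.elim (fun q : {q : Fin (n + 1) × Fin (n + 1) // q.2 ≠ q.1} => (q.1.2 : ℕ))
    (fun _ : Fin n => n) v.1

/-- The index `i` of the set `Y_i` or `Z_i` of the point. -/
def plane (v : WitnessLabel n) : Fin (n + 1) := Sum.elim (fun q => q.1.1) Fin.castSucc v.1

/-- The first coordinates of the four directions. -/
def dirX : Fin 4 → ℝ := ![1, 0, -1, 0]

/-- The second coordinates of the four directions. -/
def dirY : Fin 4 → ℝ := ![0, 1, 0, -1]

/-- The point with a given label. -/
noncomputable def point (v : WitnessLabel n) : Fin 3 → ℝ :=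
  ![witnessRadius n v.index * dirX v.2, witnessRadius n v.index * dirY v.2, v.level * n]

theorem index_le (v : WitnessLabel n) : v.index ≤ n := by
  rcases v with ⟨q | i, a⟩
  · exact Nat.lt_succ_iff.1 q.1.2.isLt
  · exact Nat.zero_le _

theorem mem_directions (a : Fin 4) : (dirX a, dirY a) ∈ directions := by
  fin_cases a <;> simp [dirX, dirY, directions]

theorem exists_of_mem_directions {a : ℝ × ℝ} (ha : a ∈ directions) :
    ∃ i, a = (dirX i, dirY i) := by
  rcases ha with rfl | rfl | rfl | rfl
  · exact ⟨0, by simp [dirX, dirY]⟩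
  · exact ⟨1, by simp [dirX, dirY]⟩
  · exact ⟨2, by simp [dirX, dirY]⟩
  · exact ⟨3, by simp [dirX, dirY]⟩

theorem point_inl_mem (q : {q : Fin (n + 1) × Fin (n + 1) // q.2 ≠ q.1}) (a : Fin 4) :
    point (Sum.inl q, a) ∈ witnessSquare n q.1.2 (2 * (q.1.1 : ℕ) * n) :=
  ⟨_, mem_directions a, by simp [point, index, level]⟩

theorem point_inr_mem (i : Fin n) (a : Fin 4) : point (Sum.inr i, a) ∈ witnessZ n i :=
  ⟨_, mem_directions a, by simp [point, index, level]⟩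

theorem point_mem (v : WitnessLabel n) : v.point ∈ witnessSet n := by
  rcases v with ⟨q | i, a⟩
  · refine Or.inl (Set.mem_iUnion₂.2 ⟨q.1.1, Nat.lt_succ_iff.1 q.1.1.isLt,
      Set.mem_iUnion₂.2 ⟨q.1.2, ⟨Nat.lt_succ_iff.1 q.1.2.isLt, fun h => q.2 (Fin.ext h)⟩,
        point_inl_mem q a⟩⟩)
  · exact Or.inr (Set.mem_iUnion₂.2 ⟨i, i.isLt, point_inr_mem i a⟩)

theorem exists_point_eq {w : Fin 3 → ℝ} (hw : w ∈ witnessSet n) :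
    ∃ v : WitnessLabel n, v.point = w := by
  rcases hw with hw | hw
  · obtain ⟨i, hi, hw⟩ := Set.mem_iUnion₂.1 hw
    obtain ⟨j, ⟨hj, hji⟩, b, hb, rfl⟩ := Set.mem_iUnion₂.1 hw
    obtain ⟨a, rfl⟩ := exists_of_mem_directions hb
    exact ⟨(Sum.inl ⟨(⟨i, Nat.lt_succ_iff.2 hi⟩, ⟨j, Nat.lt_succ_iff.2 hj⟩),
      fun h => hji (congrArg Fin.val h)⟩, a), by simp [point, index, level]⟩
  · obtain ⟨i, hi, b, hb, rfl⟩ := Set.mem_iUnion₂.1 hw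
    obtain ⟨a, rfl⟩ := exists_of_mem_directions hb
    exact ⟨(Sum.inr ⟨i, hi⟩, a), by simp [point, index, level]⟩

theorem witnessGamma_point (hn : 2 ≤ n) (v : WitnessLabel n) :
    witnessGamma n ⟨v.point, v.point_mem⟩ = v.value := by
  rcases v with ⟨q | i, a⟩
  · exact witnessGamma_of_mem_Y (i := q.1.1) hn (Nat.lt_succ_iff.1 q.1.2.isLt) _ (point_inl_mem q a)
  · exact witnessGamma_of_mem_Z i.isLt _ (point_inr_mem i a)

/-- The correction `j / n²` is at most `1 / n ≤ 1 / 2`. Hence radii differ by less than any scale in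
use, while the sum of two radii exceeds every such scale; these are the two inequalities required by
`horizontal_iff`. -/
theorem radius_bounds (hn : 2 ≤ n) {j : ℕ} (hj : j ≤ n) :
    (n : ℝ) - 1 / 2 ≤ witnessRadius n j ∧ witnessRadius n j ≤ n := by
  have hn' : (2 : ℝ) ≤ n := by exact_mod_cast hn
  have hj' : (j : ℝ) ≤ n := by exact_mod_cast hj
  unfold witnessRadius
  constructor
  · have : (j : ℝ) / (n : ℝ) ^ 2 ≤ 1 / 2 := by
      rw [div_le_div_iff₀ (by positivity) (by norm_num)]
      nlinarith
    linarith
  · have : 0 ≤ (j : ℝ) / (n : ℝ) ^ 2 := by positivity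
    linarith

theorem radius_pos (hn : 2 ≤ n) {j : ℕ} (hj : j ≤ n) : 0 < witnessRadius n j := by
  have hn' : (2 : ℝ) ≤ n := by exact_mod_cast hn
  linarith [(radius_bounds hn hj).1]

theorem radius_le_iff (hn : 2 ≤ n) {j k : ℕ} : witnessRadius n j ≤ witnessRadius n k ↔ k ≤ j := by
  have hn' : (2 : ℝ) ≤ n := by exact_mod_cast hn
  unfold witnessRadius
  rw [sub_le_sub_iff_left, div_le_div_iff_of_pos_right (by positivity)]
  exact Nat.cast_le

/-- In the supremum metric, points at radii `x` and `y` are at distance `|x - y|` in equal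
directions, `max x y` in perpendicular ones and `x + y` in opposite ones; `a + 2` is the direction
opposite to `a`. -/
theorem horizontal_iff {x y b : ℝ} (hx : 0 < x) (hy : 0 < y) (hb : 0 ≤ b) (hxy : |x - y| ≤ b)
    (hxyb : b < x + y) (a a' : Fin 4) :
    |x * dirX a - y * dirX a'| ≤ b ∧ |x * dirY a - y * dirY a'| ≤ b ↔
      a' ≠ a + 2 ∧ (a = a' ∨ x ≤ b ∧ y ≤ b) := by
  have h1 : |-x + y| ≤ b := by rwa [neg_add_eq_sub, abs_sub_comm]
  have h2 : ¬ (|x + y| ≤ b) := by rw [abs_of_pos (by positivity)]; linarith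
  have h3 : ¬ (|-x - y| ≤ b) := by
    rw [← neg_add', abs_neg]
    exact h2
  fin_cases a <;> fin_cases a' <;>
    simp [dirX, dirY, hb, hxy, h1, h2, h3, abs_of_pos hx, abs_of_pos hy, and_comm]

/-- The adjacency of two points in the bifiltration at `(p.1, β_{p.2})`. -/
def Adj (p : Fin (n + 1) × Fin (n + 1)) (v w : WitnessLabel n) : Prop :=
  (v.value ≤ p.1 ∧ w.value ≤ p.1) ∧
  (w.2 ≠ v.2 + 2 ∧ (v.2 = w.2 ∨ n ≤ v.index + p.2 ∧ n ≤ w.index + p.2)) ∧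
  (v.level = w.level ∨ (p.2 : ℕ) = n ∧ (v.level + 1 = w.level ∨ w.level + 1 = v.level))

/-- The supremum metric separates the horizontal and the vertical condition. Heights are multiples
of `n` and the scale is at most `n`, with equality only for `m = n`; so distinct levels interact
only then, and only if they are consecutive. -/
theorem dist_point_le_iff (hn : 2 ≤ n) (m : ℕ) (hm : m ≤ n) (v w : WitnessLabel n) :
    dist v.point w.point ≤ witnessRadius n (n - m) ↔
      (w.2 ≠ v.2 + 2 ∧ (v.2 = w.2 ∨ n ≤ v.index + m ∧ n ≤ w.index + m)) ∧
      (v.level = w.level ∨ m = n ∧ (v.level + 1 = w.level ∨ w.level + 1 = v.level)) := by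
  have hn' : (2 : ℝ) ≤ n := by exact_mod_cast hn
  obtain ⟨hv1, hv2⟩ := radius_bounds hn v.index_le
  obtain ⟨hw1, hw2⟩ := radius_bounds hn w.index_le
  obtain ⟨hb1, hb2⟩ := radius_bounds hn (Nat.sub_le n m)
  rw [dist_pi_le_iff (by linarith)]
  simp only [Fin.forall_fin_succ, Real.dist_eq, point, Matrix.cons_val_zero,
    Matrix.cons_val_succ, IsEmpty.forall_iff, and_true]
  rw [← and_assoc, horizontal_iff (by linarith) (by linarith) (by linarith)
    (by rw [abs_le]; constructor <;> linarith) (by linarith), radius_le_iff hn, radius_le_iff hn]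
  refine and_congr (and_congr_right fun _ => or_congr_right ?_) ?_
  · omega
  · rw [← sub_mul, abs_mul, abs_of_nonneg (by linarith : (0 : ℝ) ≤ n)]
    have hn0 : witnessRadius n 0 = n := by simp [witnessRadius]
    have hone : (n : ℝ) ≤ witnessRadius n (n - m) ↔ m = n := by
      rw [← hn0, hn0, ← hn0, radius_le_iff hn]
      omega
    have key : ∀ k l : ℕ, k < l → (|(k : ℝ) - l| * n ≤ witnessRadius n (n - m) ↔
        m = n ∧ k + 1 = l) := by
      intro k l hkl
      rw [abs_sub_comm, abs_of_nonneg (sub_nonneg.2 (Nat.cast_le.2 hkl.le))]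
      obtain ⟨d, rfl⟩ := Nat.exists_eq_add_of_lt hkl
      push_cast
      rw [show ((k : ℝ) + d + 1 - k) = d + 1 by ring]
      by_cases hd : d = 0
      · subst hd
        simpa using hone
      · have hd' : (1 : ℝ) ≤ d := by exact_mod_cast Nat.one_le_iff_ne_zero.2 hd
        constructor
        · intro h
          nlinarith
        · rintro ⟨-, h⟩
          omega
    rcases lt_trichotomy v.level w.level with h | h | h
    · rw [key _ _ h]
      omega
    · rw [h, sub_self, abs_zero, zero_mul]
      simp
      linarith
    · rw [abs_sub_comm, key _ _ h]
      omega

theorem point_injective (hn : 2 ≤ n) : Function.Injective (point (n := n)) := by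
  intro v w h
  have h0 : dist v.point w.point ≤ witnessRadius n (n - 0) := by
    rw [h, dist_self]
    exact (radius_pos hn (Nat.sub_le n 0)).le
  have hn' : (n : ℝ) ≠ 0 := by exact_mod_cast (by omega : n ≠ 0)
  have hl : v.level = w.level := by
    have := congrFun h 2
    simpa [point, hn'] using this
  have hsum : ∀ v : WitnessLabel n,
      |v.point 0| + |v.point 1| = witnessRadius n v.index := by
    intro v
    have h1 : 0 < witnessRadius n v.index := radius_pos hn v.index_le
    rcases v with ⟨v, a⟩
    simp only [point, Matrix.cons_val_zero, Matrix.cons_val_one, abs_mul, abs_of_pos h1, ← mul_add]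
    fin_cases a <;> simp [dirX, dirY]
  have hi : v.index = w.index := by
    have h1 : witnessRadius n v.index = witnessRadius n w.index := by
      rw [← hsum, ← hsum, h]
    exact le_antisymm ((radius_le_iff hn).1 h1.ge) ((radius_le_iff hn).1 h1.le)
  have hd : v.2 = w.2 := by
    have h1 := ((dist_point_le_iff hn 0 (Nat.zero_le _) v w).1 h0).1.2
    have h2 : 0 < witnessRadius n v.index := radius_pos hn v.index_le
    have hx := congrFun h 0
    have hy := congrFun h 1
    simp only [point, Matrix.cons_val_zero, Matrix.cons_val_one, ← hi,
      mul_right_inj' h2.ne'] at hx hy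
    generalize v.2 = a at *
    generalize w.2 = b at *
    fin_cases a <;> fin_cases b <;> simp [dirX, dirY] at hx hy ⊢ <;> linarith
  refine Prod.ext ?_ hd
  rcases v with ⟨⟨⟨q1, q2⟩, hq⟩ | i, a⟩ <;> rcases w with ⟨⟨⟨r1, r2⟩, hr⟩ | j, b⟩ <;>
    simp only [level, index, Sum.elim_inl, Sum.elim_inr] at hl hi
  · have e1 : q1 = r1 := Fin.ext (by omega)
    have e2 : q2 = r2 := Fin.ext hi
    subst e1 e2
    rfl
  · omega
  · omega
  · rw [show i = j from Fin.ext (by omega)]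

/-- The points of the witness are in bijection with their labels. -/
noncomputable def equiv (hn : 2 ≤ n) : WitnessLabel n ≃ witnessSet n :=
  Equiv.ofBijective (fun v => ⟨v.point, v.point_mem⟩)
    ⟨fun _ _ h => point_injective hn (congrArg Subtype.val h), fun w => by
      obtain ⟨v, hv⟩ := exists_point_eq w.2
      exact ⟨v, Subtype.ext hv⟩⟩

theorem ncard_witnessSet (hn : 2 ≤ n) : (witnessSet n).ncard = 4 * n * (n + 2) := by
  have h1 : Fintype.card {q : Fin (n + 1) × Fin (n + 1) // q.2 ≠ q.1} = (n + 1) * n := by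
    have h2 : Fintype.card {q : Fin (n + 1) × Fin (n + 1) // q.2 = q.1} = n + 1 := by
      rw [Fintype.card_congr (β := Fin (n + 1))
        ⟨fun q => q.1.1, fun i => ⟨(i, i), rfl⟩, fun q => Subtype.ext (Prod.ext rfl q.2.symm),
          fun _ => rfl⟩, Fintype.card_fin]
    rw [Fintype.card_subtype_compl, h2, Fintype.card_prod, Fintype.card_fin]
    have : (n + 1) * (n + 1) = (n + 1) * n + (n + 1) := by ring
    omega
  rw [← Nat.card_coe_set_eq, ← Nat.card_congr (equiv hn), Nat.card_eq_fintype_card,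
    Fintype.card_prod, Fintype.card_sum, h1, Fintype.card_fin, Fintype.card_fin]
  ring

theorem mem_faces_iff (hn : 2 ≤ n) (p : Fin (n + 1) × Fin (n + 1)) (s : Finset (witnessSet n)) :
    s ∈ (sublevelRips (witnessGamma n) (gridEmbedding n 1 p)).faces ↔ s.Nonempty ∧
      ∀ x ∈ s, ∀ y ∈ s, Adj p ((equiv hn).symm x) ((equiv hn).symm y) := by
  have hr : ((1 * (witnessRadius n (n - p.2)).toNNReal : ℝ≥0) : ℝ) = witnessRadius n (n - p.2) := by
    rw [one_mul, Real.coe_toNNReal _ (radius_pos hn (Nat.sub_le n p.2)).le]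
  have hg : ∀ v, witnessGamma n (equiv hn v) ≤ ((p.1 : ℕ) : ℝ) ↔ v.value ≤ p.1 := fun v =>
    (iff_of_eq (congrArg (· ≤ ((p.1 : ℕ) : ℝ)) (witnessGamma_point hn v))).trans Nat.cast_le
  have hd := fun v w : WitnessLabel n =>
    (iff_of_eq (congrArg (dist (equiv hn v) (equiv hn w) ≤ ·) hr)).trans
      (dist_point_le_iff hn p.2 (Nat.lt_succ_iff.1 p.2.isLt) v w)
  change (_ ∧ (s : Set _) ⊆ {x | witnessGamma n x ≤ ((p.1 : ℕ) : ℝ)} ∧ ∀ x ∈ s, ∀ y ∈ s,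
    dist x y ≤ (1 * (witnessRadius n (n - p.2)).toNNReal : ℝ≥0)) ↔ _
  refine and_congr_right fun _ => ?_
  constructor
  · rintro ⟨h1, h2⟩ x hx y hy
    obtain ⟨v, rfl⟩ := (equiv hn).surjective x
    obtain ⟨w, rfl⟩ := (equiv hn).surjective y
    rw [Equiv.symm_apply_apply, Equiv.symm_apply_apply]
    exact ⟨⟨(hg v).1 (h1 hx), (hg w).1 (h1 hy)⟩, (hd v w).1 (h2 _ hx _ hy)⟩
  · refine fun h => ⟨fun x hx => ?_, fun x hx y hy => ?_⟩
    · obtain ⟨v, rfl⟩ := (equiv hn).surjective x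
      have := (h _ hx _ hx).1.1
      rw [Equiv.symm_apply_apply] at this
      exact (hg v).2 this
    · obtain ⟨v, rfl⟩ := (equiv hn).surjective x
      obtain ⟨w, rfl⟩ := (equiv hn).surjective y
      have := (h _ hx _ hy).2
      rw [Equiv.symm_apply_apply, Equiv.symm_apply_apply] at this
      exact (hd v w).2 this

end WitnessLabel

end Witness

/-- Balls of the supremum metric are boxes. If all distances are at most `r`, each coordinate ranges
over an interval of length at most `r`, and the midpoints of these intervals form a common centre.
-/
theorem cechComplex_half_eq_ripsComplex {ι : Type} [Fintype ι] {X : Set (ι → ℝ)} (S : Set X)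
    (r : ℝ≥0) : cechComplex S (1 / 2 * r) = ripsComplex S (1 * r) := by
  classical
  ext s
  change (_ ∧ _ ∧ _) ↔ (_ ∧ _ ∧ _)
  refine and_congr_right fun hs => and_congr_right fun _ => ?_
  simp only [Set.Nonempty, Set.mem_iInter, Metric.mem_closedBall, NNReal.coe_mul, one_mul,
    NNReal.coe_div, NNReal.coe_one, NNReal.coe_ofNat]
  constructor
  · rintro ⟨y, hy⟩ a ha b hb
    have := dist_triangle_left (a : ι → ℝ) b y
    have h1 := hy a ha
    have h2 := hy b hb
    rw [Subtype.dist_eq]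
    linarith
  · intro h
    refine ⟨fun i => (s.inf' hs (fun x => (x : ι → ℝ) i) + s.sup' hs (fun x => (x : ι → ℝ) i)) / 2,
      fun x hx => ?_⟩
    rw [dist_pi_le_iff (by positivity)]
    intro i
    obtain ⟨a, ha, ha'⟩ := s.exists_mem_eq_inf' hs (fun x => (x : ι → ℝ) i)
    obtain ⟨b, hb, hb'⟩ := s.exists_mem_eq_sup' hs (fun x => (x : ι → ℝ) i)
    have h1 : s.inf' hs (fun x => (x : ι → ℝ) i) ≤ (x : ι → ℝ) i := s.inf'_le _ hx
    have h2 : (x : ι → ℝ) i ≤ s.sup' hs (fun x => (x : ι → ℝ) i) :=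
      s.le_sup' (fun x => (x : ι → ℝ) i) hx
    have h3 : dist ((b : ι → ℝ) i) ((a : ι → ℝ) i) ≤ r := (dist_le_pi_dist _ _ i).trans (h b hb a ha)
    rw [Real.dist_eq, ← hb', ← ha'] at h3
    have h4 := (abs_le.1 h3).2
    rw [Real.dist_eq, abs_le]
    constructor <;> linarith

/-! ### Potentials of cocycles on the witnesses -/

section Potential

variable {𝔽 : Type u} [Field 𝔽]

/-- On a `4`-cycle, every alternating function on edges is a coboundary up to a multiple of the
function supported on the edge from `0` to `1`. -/
theorem exists_potential_four_cycle (G : Fin 4 → Fin 4 → 𝔽) (h0 : ∀ a, G a a = 0)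
    (hG : ∀ a b, G a b = -G b a) :
    ∃ (F : Fin 4 → 𝔽) (c : 𝔽), ∀ a b, b ≠ a + 2 →
      G a b = F b - F a + ((if a = 0 ∧ b = 1 then c else 0) - if b = 0 ∧ a = 1 then c else 0) := by
  -- `F` integrates `G` along the path `1 → 2 → 3 → 0`, starting from `F 1 = 0`; the constant is the
  -- total around the cycle, charged to the one edge left out.
  refine ⟨![G 1 2 + G 2 3 + G 3 0, 0, G 1 2, G 1 2 + G 2 3], G 0 1 + G 1 2 + G 2 3 + G 3 0, ?_⟩
  have h10 := hG 1 0
  have h21 := hG 2 1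
  have h32 := hG 3 2
  have h03 := hG 0 3
  intro a b hab
  fin_cases a <;> fin_cases b <;> simp [h0] at hab ⊢
  all_goals first
    | ring1
    | linear_combination h10
    | linear_combination h21
    | linear_combination h32
    | linear_combination h03

namespace WitnessLabel

variable {n : ℕ}

theorem Adj.symm {p : Fin (n + 1) × Fin (n + 1)} {v w : WitnessLabel n} (h : Adj p v w) :
    Adj p w v := by
  obtain ⟨⟨h1, h2⟩, ⟨h3, h4⟩, h5⟩ := h
  refine ⟨⟨h2, h1⟩, ⟨fun e => h3 ?_, h4.imp Eq.symm And.symm⟩, ?_⟩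
  · rw [e]
    generalize w.2 = a
    fin_cases a <;> rfl
  · rcases h5 with h5 | ⟨h5, h6⟩
    · exact Or.inl h5.symm
    · exact Or.inr ⟨h5, h6.symm⟩

/-- Adjacency persists when the points are moved within their levels and directions to points of
larger index. -/
theorem Adj.move {p : Fin (n + 1) × Fin (n + 1)} {v w v' w' : WitnessLabel n} (h : Adj p v w)
    (hv : v'.value ≤ p.1 ∧ v'.level = v.level ∧ v'.2 = v.2 ∧ v.index ≤ v'.index)
    (hw : w'.value ≤ p.1 ∧ w'.level = w.level ∧ w'.2 = w.2 ∧ w.index ≤ w'.index) :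
    Adj p v' w' := by
  obtain ⟨-, ⟨h3, h4⟩, h5⟩ := h
  refine ⟨⟨hv.1, hw.1⟩, ?_, ?_⟩
  · rw [hv.2.2.1, hw.2.2.1]
    exact ⟨h3, h4.imp id fun h => ⟨by omega, by omega⟩⟩
  · rw [hv.2.1, hw.2.1]
    exact h5

theorem adj_self {p : Fin (n + 1) × Fin (n + 1)} {v : WitnessLabel n} (h : v.value ≤ p.1) :
    Adj p v v := by
  refine ⟨⟨h, h⟩, ⟨?_, Or.inl rfl⟩, Or.inl rfl⟩
  generalize v.2 = a
  fin_cases a <;> simp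

theorem level_le (v : WitnessLabel n) : v.level ≤ 2 * n := by
  rcases v with ⟨⟨⟨i, j⟩, h⟩ | i, a⟩
  · simp only [level, Sum.elim_inl]
    omega
  · simp only [level, Sum.elim_inr]
    omega

theorem value_le (v : WitnessLabel n) : v.value ≤ n := by
  rcases v with ⟨⟨⟨i, j⟩, h⟩ | i, a⟩
  · simp only [value, Sum.elim_inl]
    omega
  · simp [value]

theorem exists_level_eq (hn : 0 < n) {l : ℕ} (hl : l ≤ 2 * n) (a : Fin 4) :
    ∃ v : WitnessLabel n, v.level = l ∧ v.2 = a := by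
  rcases Nat.even_or_odd' l with ⟨i, rfl | rfl⟩
  · have : ∃ j : Fin (n + 1), j ≠ ⟨i, by omega⟩ := by
      by_cases hi : i = 0
      · exact ⟨Fin.last n, fun e => by
          have := congrArg Fin.val e
          simp only [Fin.val_last] at this
          omega⟩
      · exact ⟨0, fun e => hi (congrArg Fin.val e).symm⟩
    obtain ⟨j, hj⟩ := this
    exact ⟨(Sum.inl ⟨(⟨i, by omega⟩, j), hj⟩, a), rfl, rfl⟩
  · exact ⟨(Sum.inr ⟨i, by omega⟩, a), rfl, rfl⟩

/-- In every level and direction there is a point of largest index among those born at `p.1`. -/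
theorem exists_base (hn : 0 < n) (p : Fin (n + 1) × Fin (n + 1)) : ∃ B : ℕ → Fin 4 → WitnessLabel n,
    ∀ v : WitnessLabel n, v.value ≤ p.1 → (B v.level v.2).value ≤ p.1 ∧
      (B v.level v.2).level = v.level ∧ (B v.level v.2).2 = v.2 ∧
        v.index ≤ (B v.level v.2).index := by
  have key : ∀ (l : ℕ) (a : Fin 4), ∃ b : WitnessLabel n, ∀ v : WitnessLabel n,
      v.value ≤ p.1 → v.level = l → v.2 = a →
        b.value ≤ p.1 ∧ b.level = l ∧ b.2 = a ∧ v.index ≤ b.index := by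
    intro l a
    let s : Set (WitnessLabel n) := {v | v.value ≤ p.1 ∧ v.level = l ∧ v.2 = a}
    by_cases hs : s.Nonempty
    -- Largest index means smallest radius, so this point inherits the adjacencies of every other
    -- point of its level and direction.
    · obtain ⟨b, ⟨hb1, hb2, hb3⟩, hb⟩ := Set.exists_max_image s index (Set.toFinite s) hs
      exact ⟨b, fun v h1 h2 h3 => ⟨hb1, hb2, hb3, hb v ⟨h1, h2, h3⟩⟩⟩
    · obtain ⟨b, -⟩ := exists_level_eq hn (Nat.zero_le _) 0
      exact ⟨b, fun v h1 h2 h3 => absurd ⟨v, h1, h2, h3⟩ hs⟩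
  choose B hB using key
  exact ⟨B, fun v hv => hB _ _ v hv rfl rfl⟩

/-- Away from the top of the grid there are no edges between different levels. -/
theorem Adj.level_eq {p : Fin (n + 1) × Fin (n + 1)} (hp : (p.1 : ℕ) + p.2 < 2 * n)
    {v w : WitnessLabel n} (h : Adj p v w) : v.level = w.level := by
  obtain ⟨⟨h1, h2⟩, -, h5 | ⟨h5, h6⟩⟩ := h
  · exact h5
  -- Of two consecutive levels one is odd, hence belongs to some `Z_i`, whose points have value `n`.
  -- This forces `p.1 = n` besides `p.2 = n`.
  · rcases v with ⟨⟨⟨i, j⟩, hv⟩ | i, a⟩ <;> rcases w with ⟨⟨⟨k, l⟩, hw⟩ | k, b⟩ <;>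
      simp only [level, value, Sum.elim_inl, Sum.elim_inr] at * <;> omega

theorem plane_eq_of_level_eq {v w : WitnessLabel n} (h : v.level = w.level) :
    v.plane = w.plane := by
  rcases v with ⟨⟨⟨i, j⟩, hv⟩ | i, a⟩ <;> rcases w with ⟨⟨⟨k, l⟩, hw⟩ | k, b⟩ <;>
    simp only [level, plane, Sum.elim_inl, Sum.elim_inr] at h ⊢
  · exact Fin.ext (by omega)
  · omega
  · omega
  · rw [show i = k from Fin.ext (by omega)]

/-- Away from the top of the grid, adjacent points of different directions lie in a set `Y_i`. -/
theorem Adj.level_eq_two_mul_plane {p : Fin (n + 1) × Fin (n + 1)}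
    (hp : (p.1 : ℕ) + p.2 < 2 * n) {v w : WitnessLabel n} (h : Adj p v w) (hvw : v.2 ≠ w.2) :
    v.level = 2 * v.plane := by
  obtain ⟨⟨h1, h2⟩, ⟨-, h4 | ⟨h4, -⟩⟩, -⟩ := h
  · exact absurd h4 hvw
  · rcases v with ⟨⟨⟨i, j⟩, hv⟩ | i, a⟩
    · rfl
    · simp only [value, index, Sum.elim_inr] at h1 h4
      omega

/-- Sliding both ends of an edge to the base points of their level and direction costs two
triangles, so `g v w` differs from its value on base points by a coboundary. On the four base points
of a level the 4-cycle computation applies. -/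
theorem exists_potential_of_lt (hn : 0 < n) {p : Fin (n + 1) × Fin (n + 1)}
    (hp : (p.1 : ℕ) + p.2 < 2 * n) (g : WitnessLabel n → WitnessLabel n → 𝔽) (h0 : ∀ v, g v v = 0) (hg : ∀ v w, g v w = -g w v)
    (htri : ∀ u v w, Adj p u v → Adj p v w → Adj p u w → g u v + g v w = g u w) :
    ∃ (f : WitnessLabel n → 𝔽) (c : Fin (n + 1) → 𝔽), ∀ v w, Adj p v w →
      g v w = f w - f v + ((if v.2 = 0 ∧ w.2 = 1 then c v.plane else 0) -
        if w.2 = 0 ∧ v.2 = 1 then c w.plane else 0) := by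
  obtain ⟨B, hB⟩ := exists_base hn p
  choose F c hF using fun l : ℕ => exists_potential_four_cycle (fun a b => g (B l a) (B l b))
    (fun a => h0 _) (fun a b => hg _ _)
  -- Only the constants of the even levels `2 * i` are kept: at odd levels no edge joins different
  -- directions.
  refine ⟨fun v => g (B v.level v.2) v + F v.level v.2, fun i => c (2 * i), fun v w h => ?_⟩
  have hv := hB v h.1.1
  have hw := hB w h.1.2
  have iv := adj_self h.1.1
  have iw := adj_self h.1.2
  have mv : v.value ≤ p.1 ∧ v.level = v.level ∧ v.2 = v.2 ∧ v.index ≤ v.index :=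
    ⟨h.1.1, rfl, rfl, le_rfl⟩
  have mw : w.value ≤ p.1 ∧ w.level = w.level ∧ w.2 = w.2 ∧ w.index ≤ w.index :=
    ⟨h.1.2, rfl, rfl, le_rfl⟩
  have t1 := htri v (B v.level v.2) w (iv.move mv hv) (h.move hv mw) h
  have t2 := htri (B v.level v.2) (B w.level w.2) w (h.move hv hw) (iw.move hw mw) (h.move hv mw)
  have t3 := hg v (B v.level v.2)
  have hl := h.level_eq hp
  have t4 := hF v.level v.2 w.2 h.2.1.1
  rw [hl] at t1 t2 t3 t4
  by_cases hd : v.2 = w.2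
  · have e1 : ¬ (v.2 = 0 ∧ w.2 = 1) := fun e => by rw [hd, e.2] at e; exact absurd e.1 (by decide)
    have e2 : ¬ (w.2 = 0 ∧ v.2 = 1) := fun e => by rw [← hd, e.2] at e; exact absurd e.1 (by decide)
    rw [if_neg e1, if_neg e2] at t4 ⊢
    simp only [hl]
    linear_combination t4 - t1 - t2 + t3
  · have l1 := h.level_eq_two_mul_plane hp hd
    have l2 := plane_eq_of_level_eq hl
    simp only [← l2, ← l1, hl]
    linear_combination t4 - t1 - t2 + t3

/-- At the top, adjacency depends only on directions and on levels differing by at most one. The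
complex can thus be pressed down one level at a time onto level `0`, each time changing `g` by a
coboundary; a single 4-cycle, hence a single constant, remains. -/
theorem exists_potential_top (hn : 0 < n)
    (g : WitnessLabel n → WitnessLabel n → 𝔽) (h0 : ∀ v, g v v = 0) (hg : ∀ v w, g v w = -g w v)
    (htri : ∀ u v w, Adj (Fin.last n, Fin.last n) u v → Adj (Fin.last n, Fin.last n) v w →
      Adj (Fin.last n, Fin.last n) u w → g u v + g v w = g u w) :
    ∃ (f : WitnessLabel n → 𝔽) (c : 𝔽), ∀ v w, Adj (Fin.last n, Fin.last n) v w →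
      g v w = f w - f v + ((if v.2 = 0 ∧ w.2 = 1 then c else 0) -
        if w.2 = 0 ∧ v.2 = 1 then c else 0) := by
  have hadj : ∀ v w : WitnessLabel n, Adj (Fin.last n, Fin.last n) v w ↔ w.2 ≠ v.2 + 2 ∧
      (v.level = w.level ∨ v.level + 1 = w.level ∨ w.level + 1 = v.level) := by
    intro v w
    simp [Adj, value_le]
  have hself : ∀ a : Fin 4, a ≠ a + 2 := by decide
  have : Nonempty (WitnessLabel n) := (exists_level_eq hn (Nat.zero_le _) 0).nonempty
  choose! B hB using fun (l : ℕ) (hl : l ≤ 2 * n) (a : Fin 4) => exists_level_eq hn hl a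
  have hBl : ∀ (v : WitnessLabel n) (L : ℕ), (B (min v.level L) v.2).level = min v.level L ∧
      (B (min v.level L) v.2).2 = v.2 := fun v L =>
    hB _ ((min_le_left _ _).trans v.level_le) _
  -- After `k` steps every point is represented at the minimum of its level and `2 * n - k`.
  -- Truncation keeps adjacent points adjacent, so each step is again a pair of triangles.
  have key : ∀ k ≤ 2 * n, ∃ f : WitnessLabel n → 𝔽, ∀ v w, Adj (Fin.last n, Fin.last n) v w →
      g v w = f w - f v +
        g (B (min v.level (2 * n - k)) v.2) (B (min w.level (2 * n - k)) w.2) := by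
    intro k hk
    induction k with
    | zero =>
      refine ⟨fun v => g (B (min v.level (2 * n)) v.2) v, fun v w h => ?_⟩
      have hv := hBl v (2 * n)
      have hw := hBl w (2 * n)
      have lv := v.level_le
      have lw := w.level_le
      have h' := (hadj v w).1 h
      rw [Nat.sub_zero]
      beta_reduce
      generalize B (min v.level (2 * n)) v.2 = v' at *
      generalize B (min w.level (2 * n)) w.2 = w' at *
      have t1 := htri v v' w ((hadj _ _).2 ⟨by rw [hv.2]; exact hself _, by omega⟩)
        ((hadj _ _).2 ⟨by rw [hv.2]; exact h'.1, by omega⟩) h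
      have t2 := htri v' w' w ((hadj _ _).2 ⟨by rw [hv.2, hw.2]; exact h'.1, by omega⟩)
        ((hadj _ _).2 ⟨by rw [hw.2]; exact hself _, by omega⟩)
        ((hadj _ _).2 ⟨by rw [hv.2]; exact h'.1, by omega⟩)
      linear_combination hg v v' - t1 - t2
    | succ k ih =>
      obtain ⟨f, hf⟩ := ih (by omega)
      refine ⟨fun v => f v + g (B (min v.level (2 * n - (k + 1))) v.2)
        (B (min v.level (2 * n - k)) v.2), fun v w h => ?_⟩
      have hvw := hf v w h
      have hv := hBl v (2 * n - k)
      have hw := hBl w (2 * n - k)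
      have hv1 := hBl v (2 * n - (k + 1))
      have hw1 := hBl w (2 * n - (k + 1))
      have h' := (hadj v w).1 h
      beta_reduce
      generalize B (min v.level (2 * n - k)) v.2 = v' at *
      generalize B (min w.level (2 * n - k)) w.2 = w' at *
      generalize B (min v.level (2 * n - (k + 1))) v.2 = v'' at *
      generalize B (min w.level (2 * n - (k + 1))) w.2 = w'' at *
      have t1 := htri v' v'' w' ((hadj _ _).2 ⟨by rw [hv.2, hv1.2]; exact hself _, by omega⟩)
        ((hadj _ _).2 ⟨by rw [hv1.2, hw.2]; exact h'.1, by omega⟩)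
        ((hadj _ _).2 ⟨by rw [hv.2, hw.2]; exact h'.1, by omega⟩)
      have t2 := htri v'' w'' w' ((hadj _ _).2 ⟨by rw [hv1.2, hw1.2]; exact h'.1, by omega⟩)
        ((hadj _ _).2 ⟨by rw [hw.2, hw1.2]; exact hself _, by omega⟩)
        ((hadj _ _).2 ⟨by rw [hv1.2, hw.2]; exact h'.1, by omega⟩)
      linear_combination hvw + hg v' v'' - t1 - t2
  obtain ⟨f, hf⟩ := key (2 * n) le_rfl
  obtain ⟨F, c, hF⟩ := exists_potential_four_cycle (fun a b => g (B 0 a) (B 0 b))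
    (fun a => h0 _) (fun a b => hg _ _)
  refine ⟨fun v => f v + F v.2, c, fun v w h => ?_⟩
  have h1 := hf v w h
  have h2 := hF v.2 w.2 h.2.1.1
  simp only [Nat.sub_self, Nat.min_zero] at h1
  linear_combination h1 + h2

end WitnessLabel

end Potential

/-! ### The homology of the witnesses -/

section SubquotientMap

variable {𝔽 : Type u} [Field 𝔽] {W W' : Type u} [AddCommGroup W] [Module 𝔽 W] [AddCommGroup W']
  [Module 𝔽 W']

/-- The map of subquotients induced by a linear map. -/
def Subquotient.mapOfLinear {Z B : Submodule 𝔽 W} {Z' B' : Submodule 𝔽 W'} (L : W →ₗ[𝔽] W')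
    (hZ : ∀ c ∈ Z, L c ∈ Z') (hB : ∀ c ∈ B, L c ∈ B') :
    Subquotient Z B →ₗ[𝔽] Subquotient Z' B' :=
  Submodule.mapQ (B.submoduleOf Z) (B'.submoduleOf Z') (L.restrict hZ) fun _ hc => hB _ hc

theorem Subquotient.mapOfLinear_mk {Z B : Submodule 𝔽 W} {Z' B' : Submodule 𝔽 W'} (L : W →ₗ[𝔽] W')
    (hZ : ∀ c ∈ Z, L c ∈ Z') (hB : ∀ c ∈ B, L c ∈ B') (c : Z) :
    Subquotient.mapOfLinear L hZ hB (Subquotient.mk Z B c) =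
      Subquotient.mk Z' B' ⟨L c, hZ c c.2⟩ := rfl

theorem Subquotient.mapOfLinear_bijective {Z B : Submodule 𝔽 W} {Z' B' : Submodule 𝔽 W'}
    (L : W →ₗ[𝔽] W') (hZ : ∀ c ∈ Z, L c ∈ Z') (hB : ∀ c ∈ B, L c ∈ B')
    (hinj : ∀ c ∈ Z, L c ∈ B' → c ∈ B) (hsurj : ∀ d ∈ Z', ∃ c ∈ Z, L c = d) :
    Function.Bijective (Subquotient.mapOfLinear L hZ hB) := by
  constructor
  · rw [injective_iff_map_eq_zero]
    intro x hx
    obtain ⟨c, rfl⟩ := Subquotient.mk_surjective _ _ x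
    rw [Subquotient.mapOfLinear_mk, Subquotient.mk_eq_zero] at hx
    exact (Subquotient.mk_eq_zero c).2 (hinj c c.2 hx)
  · intro y
    obtain ⟨⟨d, hd⟩, rfl⟩ := Subquotient.mk_surjective _ _ y
    obtain ⟨c, hc, rfl⟩ := hsurj d hd
    exact ⟨Subquotient.mk _ _ ⟨c, hc⟩, rfl⟩

end SubquotientMap

namespace WitnessLabel

variable {𝔽 : Type u} [Field 𝔽] {n : ℕ} (hn : 2 ≤ n)

/-- The direction of a point of the witness. -/
noncomputable def dir (x : witnessSet n) : Fin 4 := ((equiv hn).symm x).2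

/-- The index of the set `Y_i` or `Z_i` of a point of the witness. -/
noncomputable def planeOf (x : witnessSet n) : Fin (n + 1) := ((equiv hn).symm x).plane

/-- The sublevel-Rips filtration of the witness, on the grid. -/
noncomputable abbrev ripsGrid (n : ℕ) :
    Fin (n + 1) × Fin (n + 1) →o PreAbstractSimplicialComplex (witnessSet n) :=
  (sublevelRips (witnessGamma n)).comp (gridEmbedding n 1)

/-- Adjacency of points of the witness. -/
def AdjOf (p : Fin (n + 1) × Fin (n + 1)) (x y : witnessSet n) : Prop :=
  Adj p ((equiv hn).symm x) ((equiv hn).symm y)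

/-- The contribution of an ordered edge to the winding numbers. -/
noncomputable def windingWeight (𝔽 : Type u) [Field 𝔽] (v : Fin 2 → witnessSet n) :
    (Fin 1 → Fin (n + 1)) →₀ 𝔽 :=
  if dir hn (v 0) = 0 ∧ dir hn (v 1) = 1 then Finsupp.single ![planeOf hn (v 0)] 1 else 0

/-- The chain of winding numbers of a `1`-chain, one for every plane. -/
noncomputable def winding (𝔽 : Type u) [Field 𝔽] :
    ((Fin 2 → witnessSet n) →₀ 𝔽) →ₗ[𝔽] ((Fin 1 → Fin (n + 1)) →₀ 𝔽) :=
  Finsupp.linearCombination 𝔽 (windingWeight hn 𝔽)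

theorem winding_orientedSimplex (x y : witnessSet n) :
    winding hn 𝔽 (orientedSimplex 𝔽 ![x, y]) =
      windingWeight hn 𝔽 ![x, y] - windingWeight hn 𝔽 ![y, x] := by
  simp [orientedSimplex_two, winding]

variable {hn}

theorem adjOf_of_mem_chains {p : Fin (n + 1) × Fin (n + 1)} {m : ℕ}
    {c : (Fin (m + 1) → witnessSet n) →₀ 𝔽} (hc : c ∈ simplicialChains 𝔽 (ripsGrid n p) m)
    {v : Fin (m + 1) → witnessSet n} (hv : c v ≠ 0) (i j : Fin (m + 1)) :
    AdjOf hn p (v i) (v j) := by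
  obtain ⟨-, s, hs, hsv⟩ := hc.1 v hv
  have h := ((mem_faces_iff hn p s).1 hs).2
  refine h _ ?_ _ ?_
  · rw [← Finset.mem_coe, hsv]
    exact ⟨i, rfl⟩
  · rw [← Finset.mem_coe, hsv]
    exact ⟨j, rfl⟩

/-- An edge between different directions at a point of index `ℓ` needs `n - p.2 ≤ ℓ ≤ p.1`. On the
antidiagonal this leaves `ℓ = p.1`, which `Y_k` lacks for `k = p.1`: this is the purpose of omitting
`b_k A` from `Y_k`. -/
theorem singleton_mem_of_adj {p : Fin (n + 1) × Fin (n + 1)} {v w : WitnessLabel n}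
    (h : Adj p v w) (hd : v.2 ≠ w.2) (hn0 : 0 < n) : {v.plane} ∈ (modelFiltration n p).faces := by
  rw [singleton_mem_modelFiltration hn0]
  obtain ⟨⟨h1, -⟩, ⟨-, h4 | ⟨h4, -⟩⟩, -⟩ := h
  · exact absurd h4 hd
  · rcases v with ⟨⟨⟨i, j⟩, hv⟩ | i, a⟩
    · simp only [value, index, plane, Sum.elim_inl] at h1 h4 ⊢
      refine ⟨by omega, fun e e' => hv (Fin.ext ?_)⟩
      rw [← e']
      simp only
      omega
    · simp only [value, index, plane, Sum.elim_inr] at h1 h4 ⊢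
      exact ⟨by omega, fun e => by omega⟩

theorem winding_mem_chains {p : Fin (n + 1) × Fin (n + 1)} {c : (Fin 2 → witnessSet n) →₀ 𝔽}
    (hc : c ∈ simplicialChains 𝔽 (ripsGrid n p) 1) :
    winding hn 𝔽 c ∈ simplicialChains 𝔽 (modelFiltration n p) 0 := by
  rw [winding, Finsupp.linearCombination_apply]
  refine Submodule.sum_mem _ fun v hv => Submodule.smul_mem _ _ ?_
  rw [Finsupp.mem_support_iff] at hv
  unfold windingWeight
  split_ifs with h
  · rw [mem_chains_zero]
    intro k hk
    have hk' : planeOf hn (v 0) = k := by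
      by_contra h'
      exact hk (Finsupp.single_eq_of_ne fun e => h' (congrFun e 0).symm)
    rw [← hk']
    refine singleton_mem_of_adj (adjOf_of_mem_chains (hn := hn) hc hv 0 1) (fun e => ?_) (by omega)
    have h1 := h.1.symm.trans (e.trans h.2)
    exact absurd h1 (by decide)
  · exact zero_mem _

/-- A linear map that does not distinguish the planes of adjacent points vanishes on the winding
numbers of boundaries. -/
theorem map_winding_boundary {N : Type*} [AddCommGroup N] [Module 𝔽 N]
    (L : ((Fin 1 → Fin (n + 1)) →₀ 𝔽) →ₗ[𝔽] N) {p : Fin (n + 1) × Fin (n + 1)}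
    (hL : ∀ x y, AdjOf hn p x y →
      L (Finsupp.single ![planeOf hn x] 1) = L (Finsupp.single ![planeOf hn y] 1))
    {c : (Fin 3 → witnessSet n) →₀ 𝔽} (hc : c ∈ simplicialChains 𝔽 (ripsGrid n p) 2) :
    L (winding hn 𝔽 (simplicialBoundary 𝔽 _ 2 c)) = 0 := by
  classical
  have h1 : L (winding hn 𝔽 (simplicialBoundary 𝔽 _ 2 c)) =
      ∑ v ∈ c.support, c v • L (windingWeight hn 𝔽 (Fin.tail v)) := by
    have h2 : simplicialBoundary 𝔽 _ 2 c = ∑ v ∈ c.support, Finsupp.single (Fin.tail v) (c v) := rfl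
    rw [h2, map_sum, map_sum]
    refine Finset.sum_congr rfl fun v _ => ?_
    rw [winding, Finsupp.linearCombination_single, map_smul]
  rw [h1, ← Finset.sum_filter_of_ne (p := fun v => dir hn (v 1) = 0 ∧ dir hn (v 2) = 1)]
  swap
  · intro v _ hv
    by_contra h
    refine hv ?_
    have : windingWeight hn 𝔽 (Fin.tail v) = 0 := if_neg h
    rw [this, map_zero, smul_zero]
  -- No triangle contains opposite directions, so one with an edge from direction `0` to direction
  -- `1` has its remaining vertex in one of these two directions. Exchanging `v 0` with the vertex
  -- of the same direction, at position `k v`, is a sign-reversing involution on the contributing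
  -- orderings.
  let k : (Fin 3 → witnessSet n) → Fin 3 := fun v => if dir hn (v 0) = 0 then 1 else 2
  have hk0 : ∀ v, (0 : Fin 3) ≠ k v := fun v => by
    simp only [k]
    split_ifs <;> decide
  have hval : ∀ v : Fin 3 → witnessSet n, dir hn (v 1) = 0 → dir hn (v 2) = 1 →
      windingWeight hn 𝔽 (Fin.tail v) = Finsupp.single ![planeOf hn (v 1)] 1 :=
    fun v h1 h2 => if_pos ⟨h1, h2⟩
  have hdir : ∀ v, c v ≠ 0 → dir hn (v 1) = 0 → dir hn (v 2) = 1 → dir hn (v 0) ≠ 0 →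
      dir hn (v 0) = 1 := by
    intro v hv h1 h2 h3
    have a1 : dir hn (v 0) ≠ dir hn (v 1) + 2 := (adjOf_of_mem_chains (hn := hn) hc hv 1 0).2.1.1
    have a2 : dir hn (v 0) ≠ dir hn (v 2) + 2 := (adjOf_of_mem_chains (hn := hn) hc hv 2 0).2.1.1
    rw [h1] at a1
    rw [h2] at a2
    generalize dir hn (v 0) = a at *
    revert a
    decide
  have hswap : ∀ v, c (v ∘ Equiv.swap 0 (k v)) = -c v := fun v => by
    rw [hc.2, Equiv.Perm.sign_swap (hk0 v)]
    simp
  have hcases : ∀ v, c v ≠ 0 → dir hn (v 1) = 0 → dir hn (v 2) = 1 →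
      (dir hn ((v ∘ Equiv.swap 0 (k v)) 1) = 0 ∧ dir hn ((v ∘ Equiv.swap 0 (k v)) 2) = 1) ∧
      k (v ∘ Equiv.swap 0 (k v)) = k v ∧
      L (Finsupp.single ![planeOf hn ((v ∘ Equiv.swap 0 (k v)) 1)] 1) =
        L (Finsupp.single ![planeOf hn (v 1)] 1) := by
    intro v hv h1 h2
    by_cases h3 : dir hn (v 0) = 0
    · have hk : k v = 1 := if_pos h3
      have e2 : Equiv.swap (0 : Fin 3) 1 2 = 2 := by decide
      rw [hk]
      refine ⟨⟨by simpa using h3, by simpa [e2] using h2⟩, if_pos (by simpa using h1), ?_⟩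
      -- Here the exchange may change the plane that is recorded, which `L` does not see.
      simpa using hL _ _ (adjOf_of_mem_chains hc hv 0 1)
    · have hk : k v = 2 := if_neg h3
      have e1 : Equiv.swap (0 : Fin 3) 2 1 = 1 := by decide
      rw [hk]
      refine ⟨⟨by simpa [e1] using h1, by simpa using hdir v hv h1 h2 h3⟩,
        if_neg (by simp [h2]), by simp [e1]⟩
  refine Finset.sum_involution (fun v _ => v ∘ Equiv.swap 0 (k v)) ?_ ?_ ?_ ?_
  · intro v hv
    obtain ⟨hv, h1, h2⟩ := Finset.mem_filter.1 hv
    rw [Finsupp.mem_support_iff] at hv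
    obtain ⟨⟨h3, h4⟩, -, h5⟩ := hcases v hv h1 h2
    rw [hval v h1 h2, hval _ h3 h4, h5, hswap, neg_smul, add_neg_cancel]
  · intro v hv _ h
    have hi := (hc.1 v (Finsupp.mem_support_iff.1 (Finset.mem_filter.1 hv).1)).1
    have h0 := congrFun h 0
    simp only [Function.comp_apply, Equiv.swap_apply_left] at h0
    exact hk0 v (hi h0).symm
  · intro v hv
    obtain ⟨hv, h1, h2⟩ := Finset.mem_filter.1 hv
    rw [Finsupp.mem_support_iff] at hv
    refine Finset.mem_filter.2 ⟨?_, (hcases v hv h1 h2).1⟩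
    rwa [Finsupp.mem_support_iff, hswap, neg_ne_zero]
  · intro v hv
    obtain ⟨hv, h1, h2⟩ := Finset.mem_filter.1 hv
    rw [Finsupp.mem_support_iff] at hv
    rw [(hcases v hv h1 h2).2.1]
    funext i
    simp

theorem eq_top_of_not_lt {p : Fin (n + 1) × Fin (n + 1)} (hp : ¬ (p.1 : ℕ) + p.2 < 2 * n) :
    p = (Fin.last n, Fin.last n) :=
  Prod.ext (Fin.ext (by simp only [Fin.val_last]; omega))
    (Fin.ext (by simp only [Fin.val_last]; omega))

/-- Below the top adjacent points share a plane, so the winding numbers of a boundary vanish one by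
one. At the top only their sum vanishes, and there this already makes a model chain a boundary. -/
theorem winding_mem_boundaries {p : Fin (n + 1) × Fin (n + 1)} {c : (Fin 2 → witnessSet n) →₀ 𝔽}
    (hc : c ∈ simplicialBoundaries 𝔽 (ripsGrid n p) 1) :
    winding hn 𝔽 c ∈ simplicialBoundaries 𝔽 (modelFiltration n p) 0 := by
  obtain ⟨d, hd, rfl⟩ := hc
  by_cases hp : (p.1 : ℕ) + p.2 < 2 * n
  · rw [modelFiltration_boundaries_eq_bot hp, Submodule.mem_bot]
    refine map_winding_boundary LinearMap.id (fun x y h => ?_) hd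
    rw [planeOf, planeOf, plane_eq_of_level_eq (Adj.level_eq hp h)]
  · obtain rfl := eq_top_of_not_lt hp
    refine modelFiltration_mem_boundaries (map_winding_boundary (augmentation 𝔽 _) (p := _)
      (fun x y _ => ?_) hd)
    rw [augmentation_single, augmentation_single]

end WitnessLabel

theorem injective_pair {V : Type} {x y : V} (h : x ≠ y) : Function.Injective ![x, y] := by
  intro i j e
  fin_cases i <;> fin_cases j <;> simp_all [eq_comm]

/-- A family of isomorphisms compatible with the structure maps is an isomorphism of modules. -/
def PersistenceModule.isoOfComponents {𝔽 : Type u} [Field 𝔽] {P : Type} [PartialOrder P]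
    {M N : PersistenceModule 𝔽 P} (e : ∀ p, M.obj p ≅ N.obj p)
    (h : ∀ p q (h : p ≤ q), M.map (homOfLE h) ≫ (e q).hom = (e p).hom ≫ N.map (homOfLE h)) :
    M ≅ N :=
  NatIso.ofComponents e fun f => h _ _ f.le

namespace WitnessLabel

variable {𝔽 : Type u} [Field 𝔽] {n : ℕ} {hn : 2 ≤ n}

theorem adjOf_triangle {p : Fin (n + 1) × Fin (n + 1)} {x y z : witnessSet n}
    (hxy : AdjOf hn p x y) (hyz : AdjOf hn p y z) (hxz : AdjOf hn p x z)
    (φ : ((Fin 2 → witnessSet n) →₀ 𝔽) →ₗ[𝔽] 𝔽)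
    (hφ : simplicialBoundaries 𝔽 (ripsGrid n p) 1 ≤ LinearMap.ker φ) :
    φ (orientedSimplex 𝔽 ![x, y]) + φ (orientedSimplex 𝔽 ![y, z]) =
      φ (orientedSimplex 𝔽 ![x, z]) := by
  classical
  have h0 : ∀ x : witnessSet n, orientedSimplex 𝔽 ![x, x] = 0 := fun x => by
    rw [orientedSimplex_two, sub_self]
  by_cases h1 : x = y
  · rw [h1, h0, map_zero, zero_add]
  by_cases h2 : y = z
  · rw [h2, h0, map_zero, add_zero]
  rw [orientedSimplex_swap 𝔽 x z, map_neg, eq_neg_iff_add_eq_zero]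
  by_cases h3 : x = z
  · rw [h3, h0, map_zero, add_zero, orientedSimplex_swap, map_neg, neg_add_cancel]
  rw [← map_add, ← map_add, ← simplicialBoundary_three]
  refine hφ ⟨_, orientedSimplex_mem_chains 𝔽 ?_ (s := {x, y, z}) ?_ ?_, rfl⟩
  · intro i j h
    fin_cases i <;> fin_cases j <;> simp_all [eq_comm]
  · refine (mem_faces_iff hn p _).2 ⟨by simp, fun a ha b hb => ?_⟩
    have s1 := adj_self hxy.1.1
    have s2 := adj_self hxy.1.2
    have s3 := adj_self hyz.1.2
    simp only [Finset.mem_insert, Finset.mem_singleton] at ha hb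
    rcases ha with rfl | rfl | rfl <;> rcases hb with rfl | rfl | rfl <;>
      first | assumption | exact Adj.symm (by assumption)
  · ext a
    simp [or_comm, or_left_comm, eq_comm]

/-- A functional on `1`-chains that vanishes on boundaries is the sum of a functional on `0`-chains
pulled back along the boundary map and of a functional on winding numbers. -/
theorem exists_potential {p : Fin (n + 1) × Fin (n + 1)}
    (φ : ((Fin 2 → witnessSet n) →₀ 𝔽) →ₗ[𝔽] 𝔽)
    (hφ : simplicialBoundaries 𝔽 (ripsGrid n p) 1 ≤ LinearMap.ker φ) :
    ∃ (f : witnessSet n → 𝔽) (c : Fin (n + 1) → 𝔽),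
      (¬ (p.1 : ℕ) + p.2 < 2 * n → ∀ i j, c i = c j) ∧ ∀ x y, AdjOf hn p x y →
        φ (orientedSimplex 𝔽 ![x, y]) = f y - f x +
          ((if dir hn x = 0 ∧ dir hn y = 1 then c (planeOf hn x) else 0) -
            if dir hn y = 0 ∧ dir hn x = 1 then c (planeOf hn y) else 0) := by
  let g : WitnessLabel n → WitnessLabel n → 𝔽 := fun v w =>
    φ (orientedSimplex 𝔽 ![equiv hn v, equiv hn w])
  have h0 : ∀ v, g v v = 0 := fun v => by
    simp only [g]
    rw [orientedSimplex_two, sub_self, map_zero]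
  have hg : ∀ v w, g v w = -g w v := fun v w => by
    simp only [g]
    rw [orientedSimplex_swap, map_neg]
  have htri : ∀ u v w, Adj p u v → Adj p v w → Adj p u w → g u v + g v w = g u w := by
    intro u v w h1 h2 h3
    refine adjOf_triangle (hn := hn) (p := p) ?_ ?_ ?_ φ hφ <;>
      simpa [AdjOf]
  by_cases hp : (p.1 : ℕ) + p.2 < 2 * n
  · obtain ⟨f, c, h⟩ := exists_potential_of_lt (by omega) hp g h0 hg htri
    refine ⟨fun x => f ((equiv hn).symm x), c, fun h => absurd hp h, fun x y hxy => ?_⟩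
    have := h _ _ hxy
    simp only [g, Equiv.apply_symm_apply] at this
    exact this
  · obtain rfl := eq_top_of_not_lt hp
    obtain ⟨f, c, h⟩ := exists_potential_top (by omega) g h0 hg htri
    refine ⟨fun x => f ((equiv hn).symm x), fun _ => c, fun _ _ _ => rfl, fun x y hxy => ?_⟩
    have := h _ _ hxy
    simp only [g, Equiv.apply_symm_apply] at this
    exact this

theorem mem_cycles_one {V : Type} {K : PreAbstractSimplicialComplex V} {c : (Fin 2 → V) →₀ 𝔽} :
    c ∈ simplicialCycles 𝔽 K 1 ↔ c ∈ simplicialChains 𝔽 K 1 ∧ simplicialBoundary 𝔽 V 1 c = 0 := by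
  rw [simplicialCycles, if_neg one_ne_zero]
  rfl

/-- By duality: a cycle outside the boundaries is detected by a functional `φ` vanishing on
boundaries. Such a `φ` is a coboundary plus a functional of the winding numbers, and both parts
vanish on `c`. -/
theorem mem_boundaries_of_winding {p : Fin (n + 1) × Fin (n + 1)}
    {c : (Fin 2 → witnessSet n) →₀ 𝔽} (hc : c ∈ simplicialCycles 𝔽 (ripsGrid n p) 1)
    (hw : winding hn 𝔽 c ∈ simplicialBoundaries 𝔽 (modelFiltration n p) 0) :
    c ∈ simplicialBoundaries 𝔽 (ripsGrid n p) 1 := by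
  by_contra hcB
  obtain ⟨φ, hφc, hφ⟩ := Submodule.exists_le_ker_of_notMem hcB
  obtain ⟨f, l, hl, hpot⟩ := exists_potential (hn := hn) φ hφ
  rw [mem_cycles_one] at hc
  let F : ((Fin 1 → witnessSet n) →₀ 𝔽) →ₗ[𝔽] 𝔽 :=
    Finsupp.linearCombination 𝔽 fun v => f (v 0)
  let Λ : ((Fin 1 → Fin (n + 1)) →₀ 𝔽) →ₗ[𝔽] 𝔽 :=
    Finsupp.linearCombination 𝔽 fun v => l (v 0)
  have hΛ : Λ (winding hn 𝔽 c) = 0 := by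
    by_cases hp : (p.1 : ℕ) + p.2 < 2 * n
    · rw [modelFiltration_boundaries_eq_bot hp, Submodule.mem_bot] at hw
      rw [hw, map_zero]
    -- At the top the constants of all planes agree, so `Λ` is a multiple of the augmentation and
    -- kills boundaries.
    · have h1 : Λ = l 0 • augmentation 𝔽 (Fin (n + 1)) := by
        ext v
        simp [Λ, augmentation_single, hl hp (v 0) 0]
      rw [h1, LinearMap.smul_apply, augmentation_boundary hw, smul_zero]
  have key : (φ - F ∘ₗ simplicialBoundary 𝔽 _ 1 - Λ ∘ₗ winding hn 𝔽) c = 0 := by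
    refine map_eq_zero_of_orientedSimplex _ hc.1 fun x y _ hxy => ?_
    have h1 := hpot x y (adjOf_of_mem_chains hc.1 hxy 0 1)
    have hF : F (simplicialBoundary 𝔽 _ 1 (orientedSimplex 𝔽 ![x, y])) = f y - f x := by
      rw [simplicialBoundary_two, map_sub]
      simp [F]
    have hW : ∀ x y, Λ (windingWeight hn 𝔽 ![x, y]) =
        if dir hn x = 0 ∧ dir hn y = 1 then l (planeOf hn x) else 0 := by
      intro x y
      rw [windingWeight, apply_ite Λ]
      simp [Λ]
    rw [LinearMap.sub_apply, LinearMap.sub_apply, LinearMap.comp_apply, LinearMap.comp_apply, hF,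
      winding_orientedSimplex, map_sub, hW, hW, h1]
    ring
  rw [LinearMap.sub_apply, LinearMap.sub_apply, LinearMap.comp_apply, LinearMap.comp_apply, hc.2,
    map_zero, hΛ, sub_zero, sub_zero] at key
  exact hφc key

theorem exists_cycle {p : Fin (n + 1) × Fin (n + 1)} {k : Fin (n + 1)}
    (hk : {k} ∈ (modelFiltration n p).faces) :
    ∃ c ∈ simplicialCycles 𝔽 (ripsGrid n p) 1, winding hn 𝔽 c = Finsupp.single ![k] 1 := by
  classical
  rw [singleton_mem_modelFiltration (by omega)] at hk
  obtain ⟨h1, h2⟩ := hk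
  -- The 4-cycle in plane `k` needs a square `b_j A` that is born by `p.1`, closed up at scale
  -- `β_{p.2}` and present in `Y_k`. The index `p.1` serves unless it equals `k`; then the point is
  -- above the antidiagonal and `p.1 - 1` is still admissible.
  obtain ⟨j, hjk, hj1, hj2⟩ : ∃ j : Fin (n + 1), j ≠ k ∧ (j : ℕ) ≤ p.1 ∧ n ≤ (j : ℕ) + p.2 := by
    by_cases h : p.1 = k
    · have h3 : (p.1 : ℕ) + p.2 ≠ n := fun e => h2 e h
      refine ⟨⟨p.1 - 1, by omega⟩, fun e => ?_, ?_, ?_⟩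
      · have := congrArg Fin.val (e.trans h.symm)
        simp only at this
        omega
      · simp only
        omega
      · simp only
        omega
    · exact ⟨p.1, h, le_rfl, h1⟩
  let x : Fin 4 → witnessSet n := fun a => equiv hn (Sum.inl ⟨(k, j), hjk⟩, a)
  have hdir : ∀ a, dir hn (x a) = a := fun a => by simp [dir, x]
  have hpl : ∀ a, planeOf hn (x a) = k := fun a => by simp [planeOf, x, plane]
  have hadj : ∀ a b, b ≠ a + 2 → AdjOf hn p (x a) (x b) := fun a b hab => by
    simp only [AdjOf, x, Equiv.symm_apply_apply]
    exact ⟨⟨hj1, hj1⟩, ⟨hab, Or.inr ⟨hj2, hj2⟩⟩, Or.inl rfl⟩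
  have hself : ∀ a : Fin 4, a ≠ a + 2 := by decide
  have hedge : ∀ a b, a ≠ b → b ≠ a + 2 →
      orientedSimplex 𝔽 ![x a, x b] ∈ simplicialChains 𝔽 (ripsGrid n p) 1 := by
    intro a b hab hab'
    have hab2 : a ≠ b + 2 := by
      revert a b
      decide
    have hxx : x a ≠ x b := fun e => hab (by rw [← hdir a, e, hdir])
    refine orientedSimplex_mem_chains 𝔽 (injective_pair hxx) (s := {x a, x b}) ?_ ?_
    · refine (mem_faces_iff hn p _).2 ⟨by simp, fun y hy z hz => ?_⟩
      simp only [Finset.mem_insert, Finset.mem_singleton] at hy hz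
      rcases hy with rfl | rfl <;> rcases hz with rfl | rfl
      · exact hadj a a (hself a)
      · exact hadj a b hab'
      · exact hadj b a hab2
      · exact hadj b b (hself b)
    · simp [Set.pair_comm]
  refine ⟨orientedSimplex 𝔽 ![x 0, x 1] + orientedSimplex 𝔽 ![x 1, x 2] +
    orientedSimplex 𝔽 ![x 2, x 3] + orientedSimplex 𝔽 ![x 3, x 0], mem_cycles_one.2 ⟨?_, ?_⟩, ?_⟩
  · exact add_mem (add_mem (add_mem (hedge 0 1 (by decide) (by decide))
      (hedge 1 2 (by decide) (by decide))) (hedge 2 3 (by decide) (by decide)))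
      (hedge 3 0 (by decide) (by decide))
  · simp only [map_add, simplicialBoundary_two]
    abel
  · have hW : ∀ a b, windingWeight hn 𝔽 ![x a, x b] =
        if a = 0 ∧ b = 1 then Finsupp.single ![k] 1 else 0 := by
      intro a b
      simp [windingWeight, hdir, hpl]
    simp only [map_add, winding_orientedSimplex, hW]
    simp

theorem exists_winding_eq {p : Fin (n + 1) × Fin (n + 1)} {d : (Fin 1 → Fin (n + 1)) →₀ 𝔽}
    (hd : d ∈ simplicialChains 𝔽 (modelFiltration n p) 0) :
    ∃ c ∈ simplicialCycles 𝔽 (ripsGrid n p) 1, winding hn 𝔽 c = d := by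
  have h1 : d ∈ (simplicialCycles 𝔽 (ripsGrid n p) 1).map (winding hn 𝔽) := by
    rw [← Finsupp.sum_single d]
    refine Submodule.sum_mem _ fun v hv => ?_
    rw [Finsupp.mem_support_iff, fin_one_eta v] at hv
    obtain ⟨c, hc, hcv⟩ := exists_cycle (𝔽 := 𝔽) (hn := hn) (mem_chains_zero.1 hd _ hv)
    refine ⟨d v • c, Submodule.smul_mem _ _ hc, ?_⟩
    rw [map_smul, hcv, ← fin_one_eta v, Finsupp.smul_single, smul_eq_mul, mul_one]
  exact h1

variable (𝔽 hn)

/-- The isomorphism between the first homology of the Rips filtration of the witness and the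
model module given by the winding numbers. -/
noncomputable def homologyIso :
    (persistentHomology 𝔽 (sublevelRips (witnessGamma n)) 1).comap (gridEmbedding n 1) ≅
      modelModule 𝔽 n :=
  PersistenceModule.isoOfComponents
    (fun p => (LinearEquiv.ofBijective (Subquotient.mapOfLinear
      (Z := simplicialCycles 𝔽 (ripsGrid n p) 1) (B := simplicialBoundaries 𝔽 (ripsGrid n p) 1)
      (Z' := simplicialCycles 𝔽 (modelFiltration n p) 0)
      (B' := simplicialBoundaries 𝔽 (modelFiltration n p) 0) (winding hn 𝔽)
      (fun c hc => by
        rw [simplicialCycles_zero]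
        exact winding_mem_chains (mem_cycles_one.1 hc).1)
      (fun c hc => winding_mem_boundaries hc))
      (Subquotient.mapOfLinear_bijective _ _ _ (fun c hc hw => mem_boundaries_of_winding hc hw)
        fun d hd => by
          rw [simplicialCycles_zero] at hd
          exact exists_winding_eq hd)).toModuleIso)
    (fun p q h => by
      ext x
      obtain ⟨x, rfl⟩ := Subquotient.mk_surjective _ _ x
      rfl)

end WitnessLabel

/-! ### The main theorem -/

theorem gridEmbedding_sup_le {n : ℕ} (s : ℝ≥0) (a b : Fin (n + 1) × Fin (n + 1)) (x : ℝ × ℝ≥0)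
    (ha : gridEmbedding n s a ≤ x) (hb : gridEmbedding n s b ≤ x) :
    gridEmbedding n s (a ⊔ b) ≤ x := by
  obtain ⟨a1, a2⟩ := a
  obtain ⟨b1, b2⟩ := b
  constructor
  · rcases le_total a1 b1 with h | h
    · change (((a1 ⊔ b1 : Fin (n + 1)) : ℕ) : ℝ) ≤ _
      rw [sup_eq_right.2 h]
      exact hb.1
    · change (((a1 ⊔ b1 : Fin (n + 1)) : ℕ) : ℝ) ≤ _
      rw [sup_eq_left.2 h]
      exact ha.1
  · rcases le_total a2 b2 with h | h
    · change s * (witnessRadius n (n - (a2 ⊔ b2 : Fin (n + 1)))).toNNReal ≤ _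
      rw [sup_eq_right.2 h]
      exact hb.2
    · change s * (witnessRadius n (n - (a2 ⊔ b2 : Fin (n + 1)))).toNNReal ≤ _
      rw [sup_eq_left.2 h]
      exact ha.2

theorem persistentHomology_comap (𝔽 : Type u) [Field 𝔽] {V P Q : Type} [PartialOrder P]
    [PartialOrder Q] (F : Q →o PreAbstractSimplicialComplex V) (g : P →o Q) (m : ℕ) :
    (persistentHomology 𝔽 F m).comap g = persistentHomology 𝔽 (F.comp g) m := rfl

theorem sublevelCech_comap_eq (𝔽 : Type u) [Field 𝔽] (n : ℕ) :
    (persistentHomology 𝔽 (sublevelCech (witnessGamma n)) 1).comap (gridEmbedding n (1 / 2)) =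
      (persistentHomology 𝔽 (sublevelRips (witnessGamma n)) 1).comap (gridEmbedding n 1) := by
  have h : (sublevelCech (witnessGamma n)).comp (gridEmbedding n (1 / 2)) =
      (sublevelRips (witnessGamma n)).comp (gridEmbedding n 1) := by
    ext1
    funext p
    exact cechComplex_half_eq_ripsComplex _ _
  rw [persistentHomology_comap, persistentHomology_comap, h]


/-- The cardinality `4 * n * (n + 2)` is at most `12 * n ^ 2`, and `n ^ (2 * k)` is negligible
against `2 ^ n`. The summand `1` in `C * 12 ^ k + 1` keeps the denominator positive, also when `C =
0`. -/
theorem exists_pow_lt_two_pow (k C N : ℕ) : ∃ n : ℕ, 2 ≤ n ∧ N ≤ 4 * n * (n + 2) ∧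
    C * (4 * n * (n + 2)) ^ k < 2 ^ (n + 1) - 1 := by
  have h1 := tendsto_pow_const_div_const_pow_of_one_lt (2 * k) (one_lt_two (α := ℝ))
  have hpos : (0 : ℝ) < 1 / (C * 12 ^ k + 1) := by positivity
  obtain ⟨n, hlt, hn⟩ := ((h1.eventually_lt_const hpos).and
    (Filter.eventually_ge_atTop (max 2 N))).exists
  have hn2 : 2 ≤ n := (le_max_left _ _).trans hn
  have hnN : N ≤ n := (le_max_right _ _).trans hn
  refine ⟨n, hn2, by nlinarith, ?_⟩
  rw [div_lt_div_iff₀ (by positivity) (by positivity), one_mul] at hlt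
  have h2 : n ^ (2 * k) * (C * 12 ^ k + 1) < 2 ^ n := by exact_mod_cast hlt
  have h3 : (4 * n * (n + 2)) ^ k ≤ 12 ^ k * n ^ (2 * k) := by
    rw [pow_mul, ← mul_pow]
    exact Nat.pow_le_pow_left (by nlinarith) k
  have h4 : C * (4 * n * (n + 2)) ^ k ≤ C * (12 ^ k * n ^ (2 * k)) := Nat.mul_le_mul_left C h3
  have h5 : 0 < n ^ (2 * k) := by positivity
  have h6 : C * (12 ^ k * n ^ (2 * k)) + n ^ (2 * k) = n ^ (2 * k) * (C * 12 ^ k + 1) := by ring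
  rw [pow_succ]
  omega

theorem mainTheorem2 (𝔽 : Type u) [Field 𝔽] :
    -- the generalized persistence diagrams in question are well defined
    (∀ (X : Type) [MetricSpace X] [Finite X] (γ : X → ℝ),
      HasFiniteGPD (persistentHomology 𝔽 (sublevelRips γ) 1)) ∧
    (∀ (d : ℕ) (_ : MetricSpace (Fin d → ℝ)) (X : Set (Fin d → ℝ)) (_ : X.Finite) (γ : X → ℝ),
      HasFiniteGPD (persistentHomology 𝔽 (sublevelCech γ) 1)) ∧
    -- no polynomial bound for sublevel-Rips
    (¬ ∃ k C N : ℕ, ∀ (X : Type) [MetricSpace X] [Finite X] (γ : X → ℝ), N ≤ Nat.card X →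
      gpdSize (persistentHomology 𝔽 (sublevelRips γ) 1) ≤ (C * Nat.card X ^ k : ℕ)) ∧
    -- no polynomial bound for sublevel-Čech
    (¬ ∃ k C N : ℕ, ∀ (d : ℕ) (_ : MetricSpace (Fin d → ℝ)) (X : Set (Fin d → ℝ)) (_ : X.Finite)
      (γ : X → ℝ), N ≤ X.ncard →
      gpdSize (persistentHomology 𝔽 (sublevelCech γ) 1) ≤ (C * X.ncard ^ k : ℕ)) ∧
    -- the explicit witnesses
    (∀ n : ℕ, 2 ≤ n →
      (witnessSet n).ncard = 4 * n * (n + 2) ∧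
      Nonempty ((persistentHomology 𝔽 (sublevelRips (witnessGamma n)) 1).comap (gridEmbedding n 1) ≅
        modelModule 𝔽 n) ∧
      Nonempty ((persistentHomology 𝔽 (sublevelCech (witnessGamma n)) 1).comap
        (gridEmbedding n (1 / 2)) ≅ modelModule 𝔽 n) ∧
      HasFiniteGPD (modelModule 𝔽 n) ∧
      (2 ^ (n + 1) - 1 : ℕ) ≤ gpdSize (modelModule 𝔽 n) ∧
      (2 ^ (n + 1) - 1 : ℕ) ≤ gpdSize (persistentHomology 𝔽 (sublevelRips (witnessGamma n)) 1) ∧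
      (2 ^ (n + 1) - 1 : ℕ) ≤
        gpdSize (persistentHomology 𝔽 (sublevelCech (witnessGamma n)) 1)) := by
  have hfin : ∀ n, 2 ≤ n → (witnessSet n).Finite := fun n hn => Set.finite_coe_iff.1
    (Finite.of_equiv _ (WitnessLabel.equiv hn))
  have hrips : ∀ n, 2 ≤ n → (2 ^ (n + 1) - 1 : ℕ) ≤
      gpdSize (persistentHomology 𝔽 (sublevelRips (witnessGamma n)) 1) := fun n hn => by
    have : Finite (witnessSet n) := hfin n hn
    exact two_pow_le_gpdSize hn (hasFiniteGPD_sublevelRips 𝔽 _ 1) _ (gridEmbedding_sup_le 1)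
      (WitnessLabel.homologyIso 𝔽 hn)
  have hcechIso : ∀ n, 2 ≤ n → Nonempty ((persistentHomology 𝔽
      (sublevelCech (witnessGamma n)) 1).comap (gridEmbedding n (1 / 2)) ≅ modelModule 𝔽 n) :=
    fun n hn => ⟨eqToIso (sublevelCech_comap_eq 𝔽 n) ≪≫ WitnessLabel.homologyIso 𝔽 hn⟩
  have hcech : ∀ n, 2 ≤ n → (2 ^ (n + 1) - 1 : ℕ) ≤
      gpdSize (persistentHomology 𝔽 (sublevelCech (witnessGamma n)) 1) := fun n hn =>
    two_pow_le_gpdSize hn (hasFiniteGPD_sublevelCech 𝔽 (hfin n hn) _ 1) _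
      (gridEmbedding_sup_le (1 / 2)) (hcechIso n hn).some
  have hcard : ∀ n, 2 ≤ n → Nat.card (witnessSet n) = 4 * n * (n + 2) := fun n hn => by
    rw [Nat.card_coe_set_eq, WitnessLabel.ncard_witnessSet hn]
  refine ⟨fun X _ _ γ => hasFiniteGPD_sublevelRips 𝔽 γ 1,
    fun d _ X hX γ => hasFiniteGPD_sublevelCech 𝔽 hX γ 1, ?_, ?_, fun n hn =>
    ⟨WitnessLabel.ncard_witnessSet hn, ⟨WitnessLabel.homologyIso 𝔽 hn⟩, hcechIso n hn,
      hasFiniteGPD_of_finite _, ?_, hrips n hn, hcech n hn⟩⟩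
  · rintro ⟨k, C, N, h⟩
    obtain ⟨n, hn, hN, hlt⟩ := exists_pow_lt_two_pow k C N
    have : Finite (witnessSet n) := hfin n hn
    have h1 := (hrips n hn).trans (h (witnessSet n) (witnessGamma n) (by rwa [hcard n hn]))
    rw [hcard n hn, Nat.cast_le] at h1
    omega
  · rintro ⟨k, C, N, h⟩
    obtain ⟨n, hn, hN, hlt⟩ := exists_pow_lt_two_pow k C N
    have h1 := (hcech n hn).trans (h 3 inferInstance (witnessSet n) (hfin n hn) (witnessGamma n)
      (by rwa [WitnessLabel.ncard_witnessSet hn]))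
    rw [WitnessLabel.ncard_witnessSet hn, Nat.cast_le] at h1
    omega
  · exact two_pow_le_gpdSize hn (hasFiniteGPD_of_finite _) OrderHom.id
      (fun a b x ha hb => sup_le ha hb)
      (PersistenceModule.isoOfComponents (fun _ => Iso.refl _) fun _ _ _ => rfl)
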